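/- **Setting.** Let $n\ge 1$ and, for $i\in[n]=\{1,\dots,n\}$, let $v_i:[0,\infty)\to[0,\infty)$ (the computation power of worker $i$) be continuous almost everywhere with $V_i(t):=\int_0^t v_i(\tau)\,d\tau<\infty$ for all $t<\infty$; also put $V_i(\infty):=\int_0^\infty v_i(\tau)\,d\tau\in[0,\infty]$. *Algorithms.* A zero-respecting algorithm in $\mathbb R^d$ is a sequence $A=\{A^k\}_{k\ge0}$ of maps $A^k:(\mathbb R^d)^k\to[0,\infty)\times[n]\times\{0,1\}\times\mathbb R^d$ such that, for all $k\ge 0$ and all $g^1,g^2,\dots\in\mathbb R^d$, writing $(t^{k+1},i^{k+1},c^{k+1},x^k)=A^k(g^1,\dots,g^k)$, one has $\operatorname{supp}(x^k)\subseteq\bigcup_{j=1}^k\operatorname{supp}(g^j)$ and $t^{k+2}\ge t^{k+1}$. *Protocol.* Put $t^0=0$ and start every worker in the state $s_i^0=(0,0,0)\in[0,\infty)\times\mathbb R^d\times\{0,1\}$. For $k=0,1,2,\dots$ let $(t^{k+1},i^{k+1},c^{k+1},x^k)=A^k(g^1,\dots,g^k)$ and, with $i=i^{k+1}$, $(s_i^{k+1},g^{k+1})=O_i(t^{k+1},x^k,s_i^k,c^{k+1})$,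 the other states being unchanged, where $$O_i(t,x,(s_t,s_x,s_q),c)=\begin{cases}((t,x,1),\,0), & c=0,\ s_q=0,\\ ((s_t,s_x,1),\,0), & c=0,\ s_q=1,\ V_i(t)-V_i(s_t)<1,\\ ((0,0,0),\,g_i(s_x;\xi^{k+1},t)), & c=0,\ s_q=1,\ V_i(t)-V_i(s_t)\ge1,\\ ((0,0,0),\,0), & c=1,\end{cases}$$ $g_i:\mathbb R^d\times\mathbb S_\xi\times[0,\infty)\to\mathbb R^d$ are the stochastic gradient mappings and $\xi^1,\xi^2,\dots$ are random elements of $\mathbb S_\xi$. **Theorem.** There are universal constants $c',c_1,c_2,c_3>0$ such that the following holds for all $n\ge1$, all $v_1,\dots,v_n$ as above, all $L,\Delta,\varepsilon>0$ and all $\sigma\ge0$ with $\varepsilon<c'L\Delta$. Put $\underline t_0=0$ and, for $k\ge1$, $$\underline t_k=\min\Big\{t\ge0:\Big(\frac1n\sum_{i=1}^n\big\lfloor c_3\,(V_i(t)-V_i(\underline t_{k-1}))\big\rfloor^{-1}\Big)^{-1}\ge\max\Big\{c_2\frac{\sigma^2}{n\varepsilon},1\Big\}\Big\}\in[0,\infty],$$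 with $\min\emptyset=\infty$, $0^{-1}=\infty$, $\infty^{-1}=0$ (and $\underline t_k=\infty$ if $\underline t_{k-1}=\infty$). Then there is a dimension $d$ such that for every zero-respecting algorithm $A$ in $\mathbb R^d$ there are a probability space, random differentiable functions $f_1,\dots,f_n:\mathbb R^d\to\mathbb R$ on it, random elements $\xi^1,\xi^2,\dots$ (on which the $f_i$ may depend) and stochastic gradient mappings $g_1,\dots,g_n$ with the following properties. 1. For every outcome, $f=\frac1n\sum_{i=1}^n f_i$ is differentiable, $\|\nabla f(x)-\nabla f(y)\|\le L\|x-y\|$ for all $x,y\in\mathbb R^d$, and there is $f^*\in\mathbb R$ with $f\ge f^*$ and $f(0)-f^*\le\Delta$. 2. The stochastic gradients are unbiased with variance at most $\sigma^2$: for every $k\ge0$, every $i\in[n]$, every $x\in\mathbb R^d$ and every $t\ge0$ (fixed, or chosen by any rule from $g^1,\dots,g^k$), $$\mathbb E\big[g_i(x;\xi^{k+1},t)\,\big|\,\mathcal H_k(x)\big]=\nabla f_i(x),\qquad \mathbb E\big[\|g_i(x;\xi^{k+1},t)-\nabla f_i(x)\|^2\,\big|\,\mathcal H_k(x)\big]\le\sigma^2$$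 almost surely, where $\mathcal H_k(x)$ is generated by the vectors $g^1,\dots,g^k$ received so far, the true local gradients $\nabla f_j(x^l)$ ($j\in[n]$, $0\le l\le k$), and $\nabla f_1(x),\dots,\nabla f_n(x)$. 3. The protocol satisfies $$\mathbb E\Big[\inf_{k\in S_t}\|\nabla f(x^k)\|^2\Big]>\varepsilon\quad\text{for } t=\tfrac12\,\underline t_{\lfloor c_1L\Delta/\varepsilon\rfloor},\qquad S_t=\{k\in\{0,1,2,\dots\}: t^k\le t\},$$ where the expectation is over all randomness. -/

import Mathlib

open MeasureTheory
open scoped NNReal ENNReal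

noncomputable section

namespace TimeOracle

/-! ### Computation powers -/

/-- `V(t) = ∫₀ᵗ v(τ) dτ` as a map `[0, ∞] → [0, ∞]`. -/
def V (v : ℝ≥0 → ℝ≥0) (t : ℝ≥0∞) : ℝ≥0∞ :=
  ∫⁻ τ in {τ : ℝ | 0 ≤ τ ∧ ENNReal.ofReal τ ≤ t}, (v τ.toNNReal : ℝ≥0∞)

/-- An admissible computation power `v : [0, ∞) → [0, ∞)`: continuous almost everywhere, with
finite integral over every bounded interval `[0, t]`. -/
structure IsComputationPower (v : ℝ≥0 → ℝ≥0) : Prop where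
  continuous_ae : ∀ᵐ τ ∂(volume.restrict (Set.Ici (0 : ℝ))), ContinuousAt v τ.toNNReal
  finite : ∀ t : ℝ≥0, V v t < ⊤

/-- The harmonic mean `((1/n) ∑ᵢ ⌊c₃ (Vᵢ(t) - Vᵢ(s))⌋⁻¹)⁻¹`, in `[0, ∞]`, so that `0⁻¹ = ∞` and
`∞⁻¹ = 0`. For `t < s` the truncated difference and hence the mean are `0`. -/
def harmonicWork {n : ℕ} (v : Fin n → ℝ≥0 → ℝ≥0) (c₃ : ℝ) (s t : ℝ≥0∞) : ℝ≥0∞ :=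
  ((n : ℝ≥0∞)⁻¹ *
    ∑ i, ((⌊c₃ * (V (v i) t - V (v i) s).toReal⌋₊ : ℕ) : ℝ≥0∞)⁻¹)⁻¹

/-- The sequence `t̲₀ = 0`,
`t̲ₖ = min {t ≥ 0 : harmonicWork from t̲ₖ₋₁ to t ≥ max {c₂ σ² / (n ε), 1}}`, with values in
`[0, ∞]` and the convention `min ∅ = ∞`. -/
def lowerTime {n : ℕ} (v : Fin n → ℝ≥0 → ℝ≥0) (c₂ c₃ σ ε : ℝ) : ℕ → ℝ≥0∞
  | 0 => 0
  | k + 1 => sInf {t : ℝ≥0∞ | t ≠ ⊤ ∧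
      ENNReal.ofReal (max (c₂ * (σ ^ 2 / (n * ε))) 1) ≤
        harmonicWork v c₃ (lowerTime v c₂ c₃ σ ε k) t}

/-! ### Algorithms, oracles and the protocol -/

/-- The output `(tᵏ⁺¹, iᵏ⁺¹, cᵏ⁺¹, xᵏ)` of one step of an algorithm. -/
structure Query (n d : ℕ) where
  time : ℝ≥0
  worker : Fin n
  cancel : Bool
  point : EuclideanSpace ℝ (Fin d)

/-- An algorithm is a sequence of maps `Aᵏ`; `Aᵏ` receives the vectors `g¹, …, gᵏ`. -/
abbrev Algorithm (n d : ℕ) : Type :=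
  (k : ℕ) → (Fin k → EuclideanSpace ℝ (Fin d)) → Query n d

/-- Zero-respecting algorithms: the support of `xᵏ` is contained in the union of the supports of
`g¹, …, gᵏ`, and the returned times are nondecreasing. -/
structure IsZeroRespecting {n d : ℕ} (A : Algorithm n d) : Prop where
  support : ∀ (k : ℕ) (g : Fin k → EuclideanSpace ℝ (Fin d)) (c : Fin d),
    (A k g).point c ≠ 0 → ∃ j, g j c ≠ 0
  time_mono : ∀ (k : ℕ) (g : Fin (k + 1) → EuclideanSpace ℝ (Fin d)),
    (A k (Fin.init g)).time ≤ (A (k + 1) g).time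

/-- The state `(s_t, s_x, s_q)` of an oracle. -/
structure OracleState (d : ℕ) where
  time : ℝ≥0
  point : EuclideanSpace ℝ (Fin d)
  busy : Bool

/-- The state `(0, 0, 0)`. -/
def idle (d : ℕ) : OracleState d := ⟨0, 0, false⟩

/-- One call of the oracle of a worker with computation power `v`; `γ x t` is the stochastic
gradient that this call returns if it finishes at time `t` a computation started at `x`. -/
def oracle {d : ℕ} (v : ℝ≥0 → ℝ≥0)
    (γ : EuclideanSpace ℝ (Fin d) → ℝ≥0 → EuclideanSpace ℝ (Fin d))
    (t : ℝ≥0) (x : EuclideanSpace ℝ (Fin d)) (s : OracleState d) (c : Bool) :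
    OracleState d × EuclideanSpace ℝ (Fin d) :=
  open scoped Classical in
  if c = true then (idle d, 0)
  else if s.busy = false then (⟨t, x, true⟩, 0)
  else if V v t - V v s.time < 1 then (s, 0)
  else (idle d, γ s.point t)

/-- The first `k` iterations of the protocol: the vectors `g¹, …, gᵏ` and the states of the
oracles. `γ k i x t` is the stochastic gradient available from worker `i` at iteration `k`. -/
def run {n d : ℕ} (v : Fin n → ℝ≥0 → ℝ≥0) (A : Algorithm n d)
    (γ : ℕ → Fin n → EuclideanSpace ℝ (Fin d) → ℝ≥0 → EuclideanSpace ℝ (Fin d)) :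
    (k : ℕ) → (Fin k → EuclideanSpace ℝ (Fin d)) × (Fin n → OracleState d)
  | 0 => (Fin.elim0, fun _ => idle d)
  | k + 1 =>
    let h := run v A γ k
    let q := A k h.1
    let o := oracle (v q.worker) (γ k q.worker) q.time q.point (h.2 q.worker) q.cancel
    (Fin.snoc h.1 o.2, Function.update h.2 q.worker o.1)

/-- The transcript `(g¹, …, gᵏ)`. -/
def transcript {n d : ℕ} (v : Fin n → ℝ≥0 → ℝ≥0) (A : Algorithm n d)
    (γ : ℕ → Fin n → EuclideanSpace ℝ (Fin d) → ℝ≥0 → EuclideanSpace ℝ (Fin d)) (k : ℕ) :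
    Fin k → EuclideanSpace ℝ (Fin d) :=
  (run v A γ k).1

/-- The point `xᵏ` of the protocol. -/
def iterate {n d : ℕ} (v : Fin n → ℝ≥0 → ℝ≥0) (A : Algorithm n d)
    (γ : ℕ → Fin n → EuclideanSpace ℝ (Fin d) → ℝ≥0 → EuclideanSpace ℝ (Fin d)) (k : ℕ) :
    EuclideanSpace ℝ (Fin d) :=
  (A k (transcript v A γ k)).point

/-- The time `tᵏ` of the protocol, with `t⁰ = 0`. -/
def iterTime {n d : ℕ} (v : Fin n → ℝ≥0 → ℝ≥0) (A : Algorithm n d)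
    (γ : ℕ → Fin n → EuclideanSpace ℝ (Fin d) → ℝ≥0 → EuclideanSpace ℝ (Fin d)) : ℕ → ℝ≥0
  | 0 => 0
  | k + 1 => (A k (transcript v A γ k)).time

/-! ### Objective functions -/

/-- `f = (1/n) ∑ᵢ fᵢ`. -/
def average {n d : ℕ} (f : Fin n → EuclideanSpace ℝ (Fin d) → ℝ) :
    EuclideanSpace ℝ (Fin d) → ℝ :=
  fun x => (n : ℝ)⁻¹ * ∑ i, f i x

/-- `F` is differentiable, `L`-smooth and bounded below by some `F⋆` with `F(0) - F⋆ ≤ Δ`. -/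
structure IsAdmissible {d : ℕ} (L Δ : ℝ) (F : EuclideanSpace ℝ (Fin d) → ℝ) : Prop where
  differentiable : Differentiable ℝ F
  smooth : ∀ x y, ‖gradient F x - gradient F y‖ ≤ L * ‖x - y‖
  gap : ∃ Fstar : ℝ, (∀ x, Fstar ≤ F x) ∧ F 0 - Fstar ≤ Δ

/-! ### Stochastic gradients

Local functions `f ω i` are random, the stochastic gradient mappings are `g i x ζ t`, and
iteration `k` uses the random element `ξ k`. The sampled functions may depend on the random
elements, so "expectation over the next random element" is the conditional expectation given
everything seen so far and the true local gradients at the point of the call. -/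

section Stochastic

variable {n d : ℕ} {Ω Ξ : Type}

/-- The realization of the stochastic gradients of all iterations for the outcome `ω`. -/
def realize (g : Fin n → EuclideanSpace ℝ (Fin d) → Ξ → ℝ≥0 → EuclideanSpace ℝ (Fin d))
    (ξ : ℕ → Ω → Ξ) (ω : Ω) :
    ℕ → Fin n → EuclideanSpace ℝ (Fin d) → ℝ≥0 → EuclideanSpace ℝ (Fin d) :=
  fun k i x t => g i x (ξ k ω) t

/-- The σ-algebra of the information before the call of iteration `k`: it is generated by
`g¹, …, gᵏ` and by the true local gradients `∇fⱼ(xˡ)`, `j ∈ [n]`, `l ≤ k`. -/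
@[reducible]
def pastInfo (v : Fin n → ℝ≥0 → ℝ≥0) (A : Algorithm n d)
    (f : Ω → Fin n → EuclideanSpace ℝ (Fin d) → ℝ)
    (g : Fin n → EuclideanSpace ℝ (Fin d) → Ξ → ℝ≥0 → EuclideanSpace ℝ (Fin d))
    (ξ : ℕ → Ω → Ξ) (k : ℕ) : MeasurableSpace Ω :=
  MeasurableSpace.comap (fun ω => transcript v A (realize g ξ ω) k) inferInstance ⊔
    ⨆ (l : Fin (k + 1)) (j : Fin n), MeasurableSpace.comap
      (fun ω => gradient (f ω j) (iterate v A (realize g ξ ω) l)) inferInstance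

/-- `pastInfo` together with the true local gradients `∇fⱼ(X)`, `j ∈ [n]`, at a random
point `X`. -/
@[reducible]
def callInfo (v : Fin n → ℝ≥0 → ℝ≥0) (A : Algorithm n d)
    (f : Ω → Fin n → EuclideanSpace ℝ (Fin d) → ℝ)
    (g : Fin n → EuclideanSpace ℝ (Fin d) → Ξ → ℝ≥0 → EuclideanSpace ℝ (Fin d))
    (ξ : ℕ → Ω → Ξ) (k : ℕ) (X : Ω → EuclideanSpace ℝ (Fin d)) : MeasurableSpace Ω :=
  pastInfo v A f g ξ k ⊔
    ⨆ j : Fin n, MeasurableSpace.comap (fun ω => gradient (f ω j) (X ω)) inferInstance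

/-- The stochastic gradients are unbiased with variance at most `σ²`: at every iteration `k`, for
every worker `i`, every point and every time (both may be fixed, or be chosen by arbitrary rules
`x`, `t` from the vectors received so far, as the oracle does with `s_x` and `tᵏ⁺¹`),
`E[g i x ξ t | info] = ∇fᵢ(x)` and `E[‖g i x ξ t - ∇fᵢ(x)‖² | info] ≤ σ²`. -/
def UnbiasedBoundedVariance [mΩ : MeasurableSpace Ω] (P : Measure Ω)
    (v : Fin n → ℝ≥0 → ℝ≥0) (A : Algorithm n d) (σ : ℝ)
    (f : Ω → Fin n → EuclideanSpace ℝ (Fin d) → ℝ)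
    (g : Fin n → EuclideanSpace ℝ (Fin d) → Ξ → ℝ≥0 → EuclideanSpace ℝ (Fin d))
    (ξ : ℕ → Ω → Ξ) : Prop :=
  ∀ (k : ℕ) (i : Fin n)
    (x : (Fin k → EuclideanSpace ℝ (Fin d)) → EuclideanSpace ℝ (Fin d))
    (t : (Fin k → EuclideanSpace ℝ (Fin d)) → ℝ≥0),
    let τ : Ω → (Fin k → EuclideanSpace ℝ (Fin d)) := fun ω => transcript v A (realize g ξ ω) k
    let X : Ω → EuclideanSpace ℝ (Fin d) := fun ω => x (τ ω)
    let G : Ω → EuclideanSpace ℝ (Fin d) := fun ω => g i (X ω) (ξ k ω) (t (τ ω))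
    let D : Ω → EuclideanSpace ℝ (Fin d) := fun ω => gradient (f ω i) (X ω)
    let m : MeasurableSpace Ω := callInfo v A f g ξ k X
    m ≤ mΩ ∧
    Integrable G P ∧
    P[G | m] =ᵐ[P] D ∧
    Integrable (fun ω => ‖G ω - D ω‖ ^ 2) P ∧
    P[fun ω => ‖G ω - D ω‖ ^ 2 | m] ≤ᵐ[P] fun _ => σ ^ 2

end Stochastic

end TimeOracle

end

/-!
The objective is a chain of links: a zero-respecting algorithm can only find coordinate `m + 1`
after coordinate `m`, and while the last coordinate is not found the gradient of the average is
large. The weight of a link is spread over the workers, and a worker reveals the next coordinate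
only if a coin flip succeeds; dividing by the success probability keeps the stochastic gradients
unbiased. If worker `i` can finish at most `Mᵢ` computations between two consecutive times
`lowerTime r` and `lowerTime (r + 1)`, then weights proportional to `Mᵢ⁻¹` allow success
probabilities for which the variance is at most `σ²` and the expected number of successes in the
round is at most `1/4`: this is where the harmonic mean comes from.

The distribution of a link over the workers has to be known only when its coordinate becomes
reachable, so it is chosen online, according to the round in which the previous coordinate was
found. With `d = 2K` coordinates and `K` rounds, a discovery either moves on to a new round, which
happens at most `K` times, or is one of the rare discoveries within a round. By Markov's inequality
the latter do not make up for the difference with probability at least `1/2`.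
-/

noncomputable section

namespace TimeOracle

/-! ### Elementary estimates -/

lemma norm_sub_le_of_hasDerivAt {E : Type*} [NormedAddCommGroup E] [NormedSpace ℝ E]
    {f f' : ℝ → E} {C : ℝ} (hf : ∀ u, HasDerivAt f (f' u) u) (hC : ∀ u, ‖f' u‖ ≤ C) (u w : ℝ) :
    ‖f u - f w‖ ≤ C * |u - w| :=
  convex_univ.norm_image_sub_le_of_norm_hasDerivWithin_le
    (fun x _ => (hf x).hasDerivWithinAt) (fun x _ => hC x) (Set.mem_univ w) (Set.mem_univ u)

lemma abs_mul_sub_mul_le {R : Type*} [CommRing R] [LinearOrder R] [IsStrictOrderedRing R]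
    {a b c d A B : R} (ha : |a| ≤ A) (hd : |d| ≤ B) :
    |a * b - c * d| ≤ A * |b - d| + B * |a - c| :=
  calc |a * b - c * d| = |a * (b - d) + d * (a - c)| := by congr 1; ring
    _ ≤ |a| * |b - d| + |d| * |a - c| := by
      simpa only [abs_mul] using abs_add_le (a * (b - d)) (d * (a - c))
    _ ≤ A * |b - d| + B * |a - c| := by gcongr

lemma hasDerivAt_max_zero_sq (u : ℝ) :
    HasDerivAt (fun x : ℝ => (max x 0) ^ 2) (2 * max u 0) u := by
  have remainder_le (x : ℝ) :
      ‖(max x 0) ^ 2 - (max u 0) ^ 2 - (x - u) • (2 * max u 0)‖ ≤ ‖‖x - u‖ ^ 2‖ := by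
    rw [norm_pow, norm_norm, Real.norm_eq_abs (x - u), sq_abs, Real.norm_eq_abs,
      smul_eq_mul, abs_le]
    rcases le_total x 0 with hx | hx <;> rcases le_total u 0 with hu | hu <;>
      simp only [hx, hu, max_eq_left, max_eq_right] <;> constructor <;> nlinarith
  rw [hasDerivAt_iff_isLittleO]
  exact (Asymptotics.isBigO_of_le _ remainder_le).trans_isLittleO
    (Asymptotics.isLittleO_pow_sub_sub u one_lt_two)

/-! ### The chain -/

/-- The smooth gate `u₊² / (1 + u₊²)`: it is closed for `u ≤ 0`, and half open at `u = 1`. -/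
def gate (u : ℝ) : ℝ := (max u 0) ^ 2 / (1 + (max u 0) ^ 2)

/-- The derivative of `gate`. -/
def gateDeriv (u : ℝ) : ℝ := 2 * max u 0 / (1 + (max u 0) ^ 2) ^ 2

/-- The bounded increasing positive function that an open gate rewards. -/
def ramp (u : ℝ) : ℝ := Real.pi / 2 + Real.arctan u

/-- The derivative of `ramp`. -/
def rampDeriv (u : ℝ) : ℝ := 1 / (1 + u ^ 2)

lemma hasDerivAt_gate (u : ℝ) : HasDerivAt gate (gateDeriv u) u := by
  have hsq := hasDerivAt_max_zero_sq u
  refine (hsq.div (hsq.const_add 1) (by positivity)).congr_deriv ?_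
  rw [gateDeriv]
  ring

lemma hasDerivAt_ramp (u : ℝ) : HasDerivAt ramp (rampDeriv u) u :=
  (Real.hasDerivAt_arctan u).const_add _

lemma gate_zero : gate 0 = 0 := by simp [gate]

lemma gateDeriv_zero : gateDeriv 0 = 0 := by simp [gateDeriv]

lemma rampDeriv_zero : rampDeriv 0 = 1 := by simp [rampDeriv]

lemma gate_nonneg (u : ℝ) : 0 ≤ gate u := by unfold gate; positivity

lemma gateDeriv_nonneg (u : ℝ) : 0 ≤ gateDeriv u := by unfold gateDeriv; positivity

lemma ramp_nonneg (u : ℝ) : 0 ≤ ramp u := by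
  unfold ramp; linarith [Real.neg_pi_div_two_lt_arctan u]

lemma rampDeriv_nonneg (u : ℝ) : 0 ≤ rampDeriv u := by unfold rampDeriv; positivity

lemma gate_le_one (u : ℝ) : gate u ≤ 1 := by
  unfold gate
  exact div_le_one_of_le₀ (by linarith) (by positivity)

lemma half_le_gate {u : ℝ} (hu : 1 ≤ u) : 1 / 2 ≤ gate u := by
  rw [gate, max_eq_left (by linarith), div_le_div_iff₀ (by norm_num) (by positivity)]
  nlinarith

lemma gateDeriv_le_one (u : ℝ) : gateDeriv u ≤ 1 := by
  unfold gateDeriv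
  refine div_le_one_of_le₀ ?_ (by positivity)
  nlinarith [sq_nonneg (max u 0 - 1), sq_nonneg (max u 0)]

lemma ramp_le_four (u : ℝ) : ramp u ≤ 4 := by
  unfold ramp; linarith [Real.arctan_lt_pi_div_two u, Real.pi_le_four]

lemma rampDeriv_le_one (u : ℝ) : rampDeriv u ≤ 1 :=
  div_le_one_of_le₀ (by nlinarith) (by positivity)

lemma half_le_rampDeriv {u : ℝ} (hu : |u| ≤ 1) : 1 / 2 ≤ rampDeriv u := by
  have hsq : u ^ 2 ≤ 1 := (sq_le_one_iff_abs_le_one u).2 hu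
  rw [rampDeriv, div_le_div_iff₀ (by norm_num) (by positivity)]
  linarith

lemma abs_gate_le_one (u : ℝ) : |gate u| ≤ 1 :=
  (abs_of_nonneg (gate_nonneg u)).trans_le (gate_le_one u)

lemma abs_gateDeriv_le_one (u : ℝ) : |gateDeriv u| ≤ 1 :=
  (abs_of_nonneg (gateDeriv_nonneg u)).trans_le (gateDeriv_le_one u)

lemma abs_ramp_le_four (u : ℝ) : |ramp u| ≤ 4 :=
  (abs_of_nonneg (ramp_nonneg u)).trans_le (ramp_le_four u)

lemma abs_rampDeriv_le_one (u : ℝ) : |rampDeriv u| ≤ 1 :=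
  (abs_of_nonneg (rampDeriv_nonneg u)).trans_le (rampDeriv_le_one u)

lemma abs_gate_sub_le (u w : ℝ) : |gate u - gate w| ≤ |u - w| := by
  simpa using norm_sub_le_of_hasDerivAt hasDerivAt_gate abs_gateDeriv_le_one u w

lemma abs_ramp_sub_le (u w : ℝ) : |ramp u - ramp w| ≤ |u - w| := by
  simpa using norm_sub_le_of_hasDerivAt hasDerivAt_ramp abs_rampDeriv_le_one u w

lemma abs_rampDeriv_sub_le (u w : ℝ) : |rampDeriv u - rampDeriv w| ≤ |u - w| := by
  have hsub : rampDeriv u - rampDeriv w = (w - u) * ((u + w) / ((1 + u ^ 2) * (1 + w ^ 2))) := by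
    unfold rampDeriv; field_simp; ring
  rw [hsub, abs_mul, abs_sub_comm w u]
  refine mul_le_of_le_one_right (abs_nonneg _) ?_
  rw [abs_div, abs_of_pos (a := (1 + u ^ 2) * (1 + w ^ 2)) (by positivity),
    div_le_one (by positivity), abs_le]
  constructor <;> nlinarith [sq_nonneg (u - 1), sq_nonneg (w - 1), sq_nonneg (u + 1),
    sq_nonneg (w + 1), mul_nonneg (sq_nonneg u) (sq_nonneg w)]

lemma hasDerivAt_two_mul_div_one_add_sq_sq (x : ℝ) :
    HasDerivAt (fun x : ℝ => 2 * x / (1 + x ^ 2) ^ 2)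
      (2 * (1 - 3 * x ^ 2) / (1 + x ^ 2) ^ 3) x := by
  have hnum : HasDerivAt (fun x : ℝ => 2 * x) 2 x := by simpa using (hasDerivAt_id x).const_mul 2
  have hden : HasDerivAt (fun x : ℝ => 1 + x ^ 2) (2 * x) x := by
    simpa using (hasDerivAt_pow 2 x).const_add 1
  refine (hnum.div (hden.pow 2) (pow_ne_zero 2 (by positivity))).congr_deriv ?_
  simp only [Pi.pow_apply]
  field_simp
  ring

lemma abs_gateDeriv_sub_le (u w : ℝ) : |gateDeriv u - gateDeriv w| ≤ 2 * |u - w| := by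
  have deriv_le (x : ℝ) : |2 * (1 - 3 * x ^ 2) / (1 + x ^ 2) ^ 3| ≤ 2 := by
    have hx := sq_nonneg x
    rw [abs_div, abs_of_pos (a := (1 + x ^ 2) ^ 3) (by positivity), div_le_iff₀ (by positivity),
      abs_le]
    constructor <;> nlinarith [mul_nonneg hx hx, mul_nonneg (mul_nonneg hx hx) hx]
  refine (norm_sub_le_of_hasDerivAt hasDerivAt_two_mul_div_one_add_sq_sq deriv_le
    (max u 0) (max w 0)).trans ?_
  exact mul_le_mul_of_nonneg_left (abs_max_sub_max_le_abs u w 0) zero_le_two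

/-- The term of the chain that couples two consecutive variables `r` and `u`: it rewards an
increase of `u` once the gate at `r` is open, and penalizes negative values of `u`. -/
def link (r u : ℝ) : ℝ := -(gate r * ramp u) + (max (-u) 0) ^ 2 / 2

/-- The derivative of `link` in its first variable. -/
def linkFst (r u : ℝ) : ℝ := -(gateDeriv r * ramp u)

/-- The derivative of `link` in its second variable. -/
def linkSnd (r u : ℝ) : ℝ := -(gate r * rampDeriv u) - max (-u) 0

lemma hasFDerivAt_link {E : Type*} [NormedAddCommGroup E] [NormedSpace ℝ E] {r u : E → ℝ}
    {r' u' : E →L[ℝ] ℝ} {x : E} (hr : HasFDerivAt r r' x) (hu : HasFDerivAt u u' x) :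
    HasFDerivAt (fun x => link (r x) (u x))
      (linkFst (r x) (u x) • r' + linkSnd (r x) (u x) • u') x := by
  have hgate := (hasDerivAt_gate (r x)).comp_hasFDerivAt x hr
  have hramp := (hasDerivAt_ramp (u x)).comp_hasFDerivAt x hu
  have hpenalty := (hasDerivAt_max_zero_sq (-u x)).comp_hasFDerivAt x hu.neg
  have hsum := (hgate.mul hramp).neg.add (hpenalty.mul_const (2 : ℝ)⁻¹)
  refine (hsum.congr_fderiv ?_).congr_of_eventuallyEq (.of_forall fun y => ?_)
  · ext y
    simp only [Function.comp_apply, add_apply, neg_apply, smul_apply, smul_eq_mul, linkFst,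
      linkSnd]
    ring
  · simp [link, div_eq_mul_inv]

lemma neg_four_le_link (r u : ℝ) : -4 ≤ link r u := by
  have hle : gate r * ramp u ≤ 1 * 4 := by
    gcongr
    exacts [ramp_nonneg u, gate_le_one r, ramp_le_four u]
  have := sq_nonneg (max (-u) 0)
  unfold link
  linarith

lemma link_zero_right_nonpos (r : ℝ) : link r 0 ≤ 0 := by
  simpa [link] using mul_nonneg (gate_nonneg r) (ramp_nonneg 0)

lemma linkFst_zero_left (u : ℝ) : linkFst 0 u = 0 := by simp [linkFst, gateDeriv_zero]

lemma linkSnd_zero_right (r : ℝ) : linkSnd r 0 = -gate r := by simp [linkSnd, rampDeriv_zero]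

lemma linkFst_nonpos (r u : ℝ) : linkFst r u ≤ 0 :=
  neg_nonpos.2 (mul_nonneg (gateDeriv_nonneg r) (ramp_nonneg u))

lemma linkSnd_le_neg_quarter {r u : ℝ} (hr : 1 ≤ r) (hu : u ≤ 1) : linkSnd r u ≤ -(1 / 4) := by
  unfold linkSnd
  rcases le_total u (-1) with hu' | hu'
  · linarith [le_max_left (-u) 0, mul_nonneg (gate_nonneg r) (rampDeriv_nonneg u)]
  · have := mul_le_mul (half_le_gate hr) (half_le_rampDeriv (abs_le.2 ⟨hu', hu⟩)) (by norm_num)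
      (gate_nonneg r)
    linarith [le_max_right (-u) 0]

lemma abs_linkFst_sub_le (r u r' u' : ℝ) :
    |linkFst r u - linkFst r' u'| ≤ 8 * |r - r'| + |u - u'| :=
  calc |linkFst r u - linkFst r' u'| = |gateDeriv r * ramp u - gateDeriv r' * ramp u'| := by
        rw [linkFst, linkFst, ← abs_neg]; congr 1; ring
    _ ≤ 1 * |ramp u - ramp u'| + 4 * |gateDeriv r - gateDeriv r'| :=
        abs_mul_sub_mul_le (abs_gateDeriv_le_one r) (abs_ramp_le_four u')
    _ ≤ 8 * |r - r'| + |u - u'| := by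
        linarith [abs_ramp_sub_le u u', abs_gateDeriv_sub_le r r']

lemma abs_linkSnd_sub_le (r u r' u' : ℝ) :
    |linkSnd r u - linkSnd r' u'| ≤ |r - r'| + 2 * |u - u'| := by
  have hgate := abs_mul_sub_mul_le (b := rampDeriv u) (c := gate r') (abs_gate_le_one r)
    (abs_rampDeriv_le_one u')
  have hpenalty : |max (-u) 0 - max (-u') 0| ≤ |u - u'| := by
    simpa only [neg_sub_neg, abs_sub_comm u' u] using abs_max_sub_max_le_abs (-u) (-u') 0
  calc |linkSnd r u - linkSnd r' u'|
      = |(gate r * rampDeriv u - gate r' * rampDeriv u') + (max (-u) 0 - max (-u') 0)| := by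
        rw [linkSnd, linkSnd, ← abs_neg]; congr 1; ring
    _ ≤ |gate r * rampDeriv u - gate r' * rampDeriv u'| + |max (-u) 0 - max (-u') 0| :=
        abs_add_le _ _
    _ ≤ |r - r'| + 2 * |u - u'| := by
        linarith [abs_rampDeriv_sub_le u u', abs_gate_sub_le r r']

section Chain

variable {d : ℕ}

/-- The variables of the chain: the constant `1`, then the coordinates in units of `ℓ`, then
`0`. In particular coordinate `c` of `x` is variable `c + 1`. -/
def chainVar (ℓ : ℝ) (x : EuclideanSpace ℝ (Fin d)) : ℕ → ℝ
  | 0 => 1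
  | j + 1 => if h : j < d then ℓ⁻¹ * x ⟨j, h⟩ else 0

/-- The derivative of `chainVar`. -/
def chainVarDeriv (d : ℕ) (ℓ : ℝ) : ℕ → EuclideanSpace ℝ (Fin d) →L[ℝ] ℝ
  | 0 => 0
  | j + 1 => if h : j < d then ℓ⁻¹ • EuclideanSpace.proj (𝕜 := ℝ) ⟨j, h⟩ else 0

/-- The chain with amplitude `a` and length scale `ℓ`, whose link `j` has the weight `W j`. -/
def chainFun (a ℓ : ℝ) (W : ℕ → ℝ) (x : EuclideanSpace ℝ (Fin d)) : ℝ :=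
  a * ∑ j ∈ Finset.range (d + 1), W j * link (chainVar ℓ x j) (chainVar ℓ x (j + 1))

/-- The gradient of `chainFun`. -/
def chainGrad (a ℓ : ℝ) (W : ℕ → ℝ) (x : EuclideanSpace ℝ (Fin d)) :
    EuclideanSpace ℝ (Fin d) :=
  WithLp.toLp 2 fun c => a * ℓ⁻¹ *
    (W c * linkSnd (chainVar ℓ x c) (chainVar ℓ x (c + 1)) +
      W (c + 1) * linkFst (chainVar ℓ x (c + 1)) (chainVar ℓ x (c + 2)))

lemma hasFDerivAt_chainVar (ℓ : ℝ) (j : ℕ) (x : EuclideanSpace ℝ (Fin d)) :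
    HasFDerivAt (fun x => chainVar ℓ x j) (chainVarDeriv d ℓ j) x := by
  cases j with
  | zero => exact hasFDerivAt_const _ _
  | succ j =>
    by_cases h : j < d
    · simp only [chainVar, chainVarDeriv, h, dite_true]
      exact ((EuclideanSpace.proj (𝕜 := ℝ) (⟨j, h⟩ : Fin d)).hasFDerivAt).const_mul ℓ⁻¹
    · simp only [chainVar, chainVarDeriv, h, dite_false]
      exact hasFDerivAt_const _ _

lemma chainVarDeriv_succ_apply (ℓ : ℝ) (c : Fin d) (y : EuclideanSpace ℝ (Fin d)) :
    chainVarDeriv d ℓ (c + 1) y = ℓ⁻¹ * y c := by simp [chainVarDeriv]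

lemma hasGradientAt_chainFun (a ℓ : ℝ) (W : ℕ → ℝ) (x : EuclideanSpace ℝ (Fin d)) :
    HasGradientAt (chainFun a ℓ W) (chainGrad a ℓ W x) x := by
  rw [hasGradientAt_iff_hasFDerivAt]
  refine ((HasFDerivAt.fun_sum (u := Finset.range (d + 1)) fun j _ => (hasFDerivAt_link
    (hasFDerivAt_chainVar ℓ j x) (hasFDerivAt_chainVar ℓ (j + 1) x)).const_mul (W j)).const_mul
      a).congr_fderiv ?_
  ext y
  have hfirst : chainVarDeriv d ℓ 0 = 0 := rfl
  have hlast : chainVarDeriv d ℓ (d + 1) = 0 := by simp [chainVarDeriv]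
  simp only [InnerProductSpace.toDual_apply_apply, PiLp.inner_apply, chainGrad,
    smul_apply, sum_apply, add_apply, smul_eq_mul, mul_add, Finset.sum_add_distrib]
  rw [Finset.sum_range_succ', Finset.sum_range_succ (n := d), hfirst, hlast]
  simp only [zero_apply, mul_zero, add_zero]
  rw [Finset.sum_range, Finset.sum_range, ← mul_add, ← Finset.sum_add_distrib, Finset.mul_sum]
  refine Finset.sum_congr rfl fun c _ => ?_
  rw [chainVarDeriv_succ_apply]
  simp only [RCLike.inner_apply, conj_trivial]
  ring

lemma gradient_chainFun (a ℓ : ℝ) (W : ℕ → ℝ) (x : EuclideanSpace ℝ (Fin d)) :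
    gradient (chainFun a ℓ W) x = chainGrad a ℓ W x :=
  (hasGradientAt_chainFun a ℓ W x).gradient

lemma differentiable_chainFun (a ℓ : ℝ) (W : ℕ → ℝ) :
    Differentiable ℝ (chainFun (d := d) a ℓ W) := fun x =>
  (hasGradientAt_chainFun a ℓ W x).differentiableAt

lemma chainGrad_one_apply (a ℓ : ℝ) (x : EuclideanSpace ℝ (Fin d)) (c : Fin d) :
    chainGrad a ℓ 1 x c = a * ℓ⁻¹ *
      (linkSnd (chainVar ℓ x c) (chainVar ℓ x (c + 1)) +
        linkFst (chainVar ℓ x (c + 1)) (chainVar ℓ x (c + 2))) := by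
  simp [chainGrad]

lemma sum_sq_chainVar_sub_le (ℓ : ℝ) (x y : EuclideanSpace ℝ (Fin d)) (N : ℕ) :
    ∑ j ∈ Finset.range N, (chainVar ℓ x j - chainVar ℓ y j) ^ 2 ≤ (ℓ⁻¹ * ‖x - y‖) ^ 2 := by
  calc ∑ j ∈ Finset.range N, (chainVar ℓ x j - chainVar ℓ y j) ^ 2
      ≤ ∑ j ∈ Finset.range (d + N + 1), (chainVar ℓ x j - chainVar ℓ y j) ^ 2 :=
        Finset.sum_le_sum_of_subset_of_nonneg (Finset.range_subset_range.2 (by omega))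
          fun _ _ _ => sq_nonneg _
    _ = ∑ c : Fin d, (chainVar ℓ x (c + 1) - chainVar ℓ y (c + 1)) ^ 2 := by
        rw [Finset.sum_range_succ', Finset.sum_range_add, Finset.sum_range]
        simp [chainVar]
    _ = (ℓ⁻¹ * ‖x - y‖) ^ 2 := by
        rw [mul_pow, EuclideanSpace.norm_sq_eq, Finset.mul_sum]
        simp [chainVar, ← mul_sub, mul_pow]

lemma sum_sq_chainVar_add_sub_le (ℓ : ℝ) (x y : EuclideanSpace ℝ (Fin d)) (i : ℕ) :
    ∑ c : Fin d, (chainVar ℓ x (c + i) - chainVar ℓ y (c + i)) ^ 2 ≤ (ℓ⁻¹ * ‖x - y‖) ^ 2 := by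
  refine le_trans ?_ (sum_sq_chainVar_sub_le ℓ x y (i + d))
  rw [Finset.sum_range_add, Finset.sum_range fun c =>
    (chainVar ℓ x (i + c) - chainVar ℓ y (i + c)) ^ 2]
  simp only [add_comm i]
  exact le_add_of_nonneg_left (Finset.sum_nonneg fun _ _ => sq_nonneg _)

lemma sq_chainGrad_one_sub_apply_le (a ℓ : ℝ) (x y : EuclideanSpace ℝ (Fin d)) (c : Fin d) :
    ((chainGrad a ℓ 1 x - chainGrad a ℓ 1 y) c) ^ 2 ≤ (a * ℓ⁻¹) ^ 2 * 300 *
      ((chainVar ℓ x c - chainVar ℓ y c) ^ 2 +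
        (chainVar ℓ x (c + 1) - chainVar ℓ y (c + 1)) ^ 2 +
        (chainVar ℓ x (c + 2) - chainVar ℓ y (c + 2)) ^ 2) := by
  have hsnd := abs_linkSnd_sub_le (chainVar ℓ x c) (chainVar ℓ x (c + 1))
    (chainVar ℓ y c) (chainVar ℓ y (c + 1))
  have hfst := abs_linkFst_sub_le (chainVar ℓ x (c + 1)) (chainVar ℓ x (c + 2))
    (chainVar ℓ y (c + 1)) (chainVar ℓ y (c + 2))
  have habs := (abs_add_le _ _).trans (add_le_add hsnd hfst)
  rw [PiLp.sub_apply, chainGrad_one_apply, chainGrad_one_apply, ← mul_sub, add_sub_add_comm,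
    mul_pow, mul_assoc]
  refine mul_le_mul_of_nonneg_left ?_ (sq_nonneg _)
  rw [← sq_abs (_ + _)]
  refine (pow_le_pow_left₀ (abs_nonneg _) habs 2).trans ?_
  simp only [← sq_abs (chainVar ℓ x _ - _)]
  nlinarith only [sq_nonneg (|chainVar ℓ x c - chainVar ℓ y c| -
      |chainVar ℓ x (c + 1) - chainVar ℓ y (c + 1)|),
    sq_nonneg (|chainVar ℓ x c - chainVar ℓ y c| - |chainVar ℓ x (c + 2) - chainVar ℓ y (c + 2)|),
    sq_nonneg (|chainVar ℓ x (c + 1) - chainVar ℓ y (c + 1)| -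
      |chainVar ℓ x (c + 2) - chainVar ℓ y (c + 2)|),
    sq_nonneg |chainVar ℓ x c - chainVar ℓ y c|,
    sq_nonneg |chainVar ℓ x (c + 1) - chainVar ℓ y (c + 1)|,
    sq_nonneg |chainVar ℓ x (c + 2) - chainVar ℓ y (c + 2)|]

lemma norm_chainGrad_one_sub_le {a ℓ : ℝ} (ha : 0 ≤ a) (hℓ : 0 < ℓ)
    (x y : EuclideanSpace ℝ (Fin d)) :
    ‖chainGrad a ℓ 1 x - chainGrad a ℓ 1 y‖ ≤ 30 * a * ℓ⁻¹ ^ 2 * ‖x - y‖ := by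
  refine le_of_sq_le_sq ?_ (by positivity)
  calc ‖chainGrad a ℓ 1 x - chainGrad a ℓ 1 y‖ ^ 2
      = ∑ c, ((chainGrad a ℓ 1 x - chainGrad a ℓ 1 y) c) ^ 2 := by
        simp only [EuclideanSpace.norm_sq_eq, Real.norm_eq_abs, sq_abs]
    _ ≤ (a * ℓ⁻¹) ^ 2 * 300 *
          (∑ c : Fin d, (chainVar ℓ x (c + 0) - chainVar ℓ y (c + 0)) ^ 2 +
            ∑ c : Fin d, (chainVar ℓ x (c + 1) - chainVar ℓ y (c + 1)) ^ 2 +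
            ∑ c : Fin d, (chainVar ℓ x (c + 2) - chainVar ℓ y (c + 2)) ^ 2) := by
        rw [← Finset.sum_add_distrib, ← Finset.sum_add_distrib, Finset.mul_sum]
        exact Finset.sum_le_sum fun c _ => sq_chainGrad_one_sub_apply_le a ℓ x y c
    _ ≤ (a * ℓ⁻¹) ^ 2 * 300 *
          ((ℓ⁻¹ * ‖x - y‖) ^ 2 + (ℓ⁻¹ * ‖x - y‖) ^ 2 + (ℓ⁻¹ * ‖x - y‖) ^ 2) := by
        gcongr <;> exact sum_sq_chainVar_add_sub_le ℓ x y _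
    _ = (30 * a * ℓ⁻¹ ^ 2 * ‖x - y‖) ^ 2 := by ring

lemma neg_le_chainFun_one {a : ℝ} (ha : 0 ≤ a) (ℓ : ℝ) (x : EuclideanSpace ℝ (Fin d)) :
    -(a * (4 * (d + 1))) ≤ chainFun a ℓ 1 x := by
  have hsum := Finset.card_nsmul_le_sum (Finset.range (d + 1))
    (fun j => link (chainVar ℓ x j) (chainVar ℓ x (j + 1))) (-4) fun j _ => neg_four_le_link _ _
  rw [chainFun, ← mul_neg]
  refine mul_le_mul_of_nonneg_left ?_ ha
  simp only [Finset.card_range, nsmul_eq_mul, Nat.cast_add, Nat.cast_one, Pi.one_apply,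
    one_mul] at hsum ⊢
  linarith

lemma chainFun_one_zero_nonpos {a : ℝ} (ha : 0 ≤ a) (ℓ : ℝ) :
    chainFun a ℓ 1 (0 : EuclideanSpace ℝ (Fin d)) ≤ 0 := by
  refine mul_nonpos_of_nonneg_of_nonpos ha (Finset.sum_nonpos fun j _ => ?_)
  have hvar : chainVar ℓ (0 : EuclideanSpace ℝ (Fin d)) (j + 1) = 0 := by simp [chainVar]
  rw [hvar, Pi.one_apply, one_mul]
  exact link_zero_right_nonpos _

lemma isAdmissible_chainFun_one {a ℓ L Δ : ℝ} (ha : 0 ≤ a) (hℓ : 0 < ℓ)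
    (hL : 30 * a * ℓ⁻¹ ^ 2 ≤ L) (hΔ : a * (4 * (d + 1)) ≤ Δ) :
    IsAdmissible L Δ (chainFun (d := d) a ℓ 1) where
  differentiable := differentiable_chainFun a ℓ 1
  smooth x y := by
    rw [gradient_chainFun, gradient_chainFun]
    exact (norm_chainGrad_one_sub_le ha hℓ x y).trans (by gcongr)
  gap := ⟨-(a * (4 * (d + 1))), neg_le_chainFun_one ha ℓ, by
    linarith [chainFun_one_zero_nonpos (d := d) ha ℓ]⟩

/- At the first variable below `1` the preceding gate is open, so this coordinate of the gradient
is large. -/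
lemma le_norm_chainGrad_one {a ℓ : ℝ} (ha : 0 ≤ a) (hℓ : 0 < ℓ)
    {x : EuclideanSpace ℝ (Fin d)} (hx : chainVar ℓ x d < 1) :
    a * ℓ⁻¹ / 4 ≤ ‖chainGrad a ℓ 1 x‖ := by
  have hex : ∃ j, chainVar ℓ x j < 1 := ⟨d, hx⟩
  obtain ⟨c, hc⟩ : ∃ c, Nat.find hex = c + 1 :=
    Nat.exists_eq_succ_of_ne_zero fun h0 => lt_irrefl 1 ((Nat.find_eq_zero hex).1 h0)
  have hcd : c < d := by have := Nat.find_min' hex hx; omega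
  have hlt : chainVar ℓ x (c + 1) < 1 := hc ▸ Nat.find_spec hex
  have hge : 1 ≤ chainVar ℓ x c := not_lt.1 (Nat.find_min hex (by omega))
  calc a * ℓ⁻¹ / 4 = a * ℓ⁻¹ * (1 / 4) := by ring
    _ ≤ a * ℓ⁻¹ * |linkSnd (chainVar ℓ x c) (chainVar ℓ x (c + 1)) +
          linkFst (chainVar ℓ x (c + 1)) (chainVar ℓ x (c + 2))| := by
        refine mul_le_mul_of_nonneg_left (le_trans ?_ (neg_le_abs _)) (by positivity)
        linarith [linkSnd_le_neg_quarter hge hlt.le,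
          linkFst_nonpos (chainVar ℓ x (c + 1)) (chainVar ℓ x (c + 2))]
    _ = ‖chainGrad a ℓ 1 x ⟨c, hcd⟩‖ := by
        rw [chainGrad_one_apply, Real.norm_eq_abs, abs_mul,
          abs_of_nonneg (a := a * ℓ⁻¹) (by positivity)]
    _ ≤ ‖chainGrad a ℓ 1 x‖ := PiLp.norm_apply_le _ _

/-- All coordinates of `x` from the `m`-th on vanish: no coordinate beyond the first `m` has been
found. -/
def SuppBelow (m : ℕ) (x : EuclideanSpace ℝ (Fin d)) : Prop := ∀ c : Fin d, m ≤ c → x c = 0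

lemma SuppBelow.mono {m m' : ℕ} (h : m ≤ m') {x : EuclideanSpace ℝ (Fin d)}
    (hx : SuppBelow m x) : SuppBelow m' x := fun c hc => hx c (h.trans hc)

lemma suppBelow_zero (m : ℕ) : SuppBelow m (0 : EuclideanSpace ℝ (Fin d)) := fun _ _ => rfl

lemma SuppBelow.chainVar_eq_zero {ℓ : ℝ} {m j : ℕ} {x : EuclideanSpace ℝ (Fin d)}
    (hx : SuppBelow m x) (hj : m < j) : chainVar ℓ x j = 0 := by
  obtain ⟨j, rfl⟩ := Nat.exists_eq_succ_of_ne_zero (Nat.ne_zero_of_lt hj)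
  rw [chainVar]
  split_ifs with h
  · rw [hx ⟨j, h⟩ (Nat.lt_succ_iff.1 hj), mul_zero]
  · rfl

lemma chainGrad_apply_frontier {a ℓ : ℝ} {W : ℕ → ℝ} {x : EuclideanSpace ℝ (Fin d)}
    {c : Fin d} (hx : SuppBelow c x) :
    chainGrad a ℓ W x c = -(a * ℓ⁻¹ * (W c * gate (chainVar ℓ x c))) := by
  simp only [chainGrad]
  rw [hx.chainVar_eq_zero (j := c + 1) (by omega), linkFst_zero_left, linkSnd_zero_right]
  ring

lemma chainGrad_apply_of_lt {a ℓ : ℝ} {m : ℕ} {W : ℕ → ℝ} {x : EuclideanSpace ℝ (Fin d)}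
    (hx : SuppBelow m x) {c : Fin d} (hc : m < c) : chainGrad a ℓ W x c = 0 := by
  rw [chainGrad_apply_frontier (hx.mono hc.le), hx.chainVar_eq_zero hc, gate_zero, mul_zero,
    mul_zero, neg_zero]

lemma chainGrad_congr {a ℓ : ℝ} {m : ℕ} {W W' : ℕ → ℝ} {x : EuclideanSpace ℝ (Fin d)}
    (hx : SuppBelow m x) (hW : ∀ j ≤ m, W j = W' j) :
    chainGrad a ℓ W x = chainGrad a ℓ W' x := by
  ext c
  rcases lt_trichotomy (c : ℕ) m with h | h | h
  · simp only [chainGrad, hW c h.le, hW (c + 1) h]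
  · rw [chainGrad_apply_frontier (h ▸ hx), chainGrad_apply_frontier (h ▸ hx), hW c h.le]
  · rw [chainGrad_apply_of_lt hx h, chainGrad_apply_of_lt hx h]

end Chain

/-! ### Work and the sequence of times -/

lemma V_mono (v : ℝ≥0 → ℝ≥0) : Monotone (V v) := fun _ _ h =>
  lintegral_mono_set fun _ hτ => ⟨hτ.1, hτ.2.trans h⟩

lemma exists_V_lt {v : ℝ≥0 → ℝ≥0} {T : ℝ≥0∞} (hT : 0 < T) (hv : V v T < ⊤) {c : ℝ≥0∞}
    (hc : c ≠ 0) : ∃ η > 0, ∀ t < η, V v t < c := by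
  set A : Set ℝ := {τ : ℝ | 0 ≤ τ ∧ ENNReal.ofReal τ ≤ T}
  obtain ⟨δ, hδ, hsmall⟩ := exists_pos_setLIntegral_lt_of_measure_lt
    (μ := volume.restrict A) (f := fun τ => (v τ.toNNReal : ℝ≥0∞)) hv.ne hc
  refine ⟨min δ T, lt_min hδ hT, fun t ht => ?_⟩
  set B : Set ℝ := {τ : ℝ | 0 ≤ τ ∧ ENNReal.ofReal τ ≤ t}
  have ht_top : t ≠ ⊤ := (ht.trans_le le_top).ne
  have hB_Icc : B ⊆ Set.Icc 0 t.toReal := fun τ hτ =>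
    ⟨hτ.1, (ENNReal.ofReal_le_iff_le_toReal ht_top).1 hτ.2⟩
  have hBA : B ⊆ A := fun τ hτ => ⟨hτ.1, hτ.2.trans (ht.le.trans (min_le_right _ _))⟩
  have hB_volume : volume.restrict A B < δ := by
    refine (Measure.restrict_apply_le _ _).trans_lt ((measure_mono hB_Icc).trans_lt ?_)
    rw [Real.volume_Icc, sub_zero, ENNReal.ofReal_toReal ht_top]
    exact ht.trans_le (min_le_left _ _)
  simpa only [V, Measure.restrict_restrict_of_subset hBA] using hsmall B hB_volume

section Work

variable {n : ℕ} {v : Fin n → ℝ≥0 → ℝ≥0} {s t : ℝ≥0∞}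

lemma harmonicWork_eq_zero {c₃ : ℝ} (i : Fin n)
    (h : ⌊c₃ * (V (v i) t - V (v i) s).toReal⌋₊ = 0) : harmonicWork v c₃ s t = 0 := by
  rw [harmonicWork, ENNReal.inv_eq_zero, ENNReal.mul_eq_top]
  refine .inl ⟨by simp, ENNReal.sum_eq_top.2 ⟨i, Finset.mem_univ i, ?_⟩⟩
  rw [h, Nat.cast_zero, ENNReal.inv_zero]

lemma one_le_V_sub {B : ℝ} (h : ENNReal.ofReal (max B 1) ≤ harmonicWork v 1 s t) (i : Fin n) :
    1 ≤ V (v i) t - V (v i) s := by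
  by_contra! hlt
  have hpos : 0 < ENNReal.ofReal (max B 1) := ENNReal.ofReal_pos.2 (by positivity)
  rw [harmonicWork_eq_zero i] at h
  · exact hpos.not_ge h
  · rw [one_mul, Nat.floor_eq_zero]
    exact ENNReal.toReal_lt_of_lt_ofReal (by simpa using hlt)

variable {c₂ c₃ σ ε : ℝ}

lemma lowerTime_le_succ (hn : 0 < n) (r : ℕ) :
    lowerTime v c₂ c₃ σ ε r ≤ lowerTime v c₂ c₃ σ ε (r + 1) := by
  rw [lowerTime]
  refine le_sInf fun t ⟨_, ht⟩ => ?_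
  by_contra! hlt
  have hpos : 0 < ENNReal.ofReal (max (c₂ * (σ ^ 2 / (n * ε))) 1) :=
    ENNReal.ofReal_pos.2 (by positivity)
  rw [harmonicWork_eq_zero ⟨0, hn⟩] at ht
  · exact hpos.not_ge ht
  · simp [tsub_eq_zero_of_le (V_mono _ hlt.le)]

lemma lowerTime_mono (hn : 0 < n) : Monotone (lowerTime v c₂ c₃ σ ε) :=
  monotone_nat_of_le_succ (lowerTime_le_succ hn)

lemma lowerTime_pos {i : Fin n} (hv : V (v i) 1 < ⊤) {r : ℕ} (hr : 0 < r) :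
    0 < lowerTime v c₂ 1 σ ε r := by
  obtain ⟨η, hη, hsmall⟩ := exists_V_lt one_pos hv one_ne_zero
  refine hη.trans_le (le_trans ?_ (lowerTime_mono i.pos (Nat.succ_le_of_lt hr)))
  rw [Nat.succ_eq_add_one, zero_add, lowerTime]
  refine le_sInf fun t ⟨_, ht⟩ => not_lt.1 fun hlt => ?_
  exact ((one_le_V_sub ht i).trans tsub_le_self).not_gt (hsmall t hlt)

lemma harmonicWork_lt_of_lt {r : ℕ} {t : ℝ≥0}
    (ht : (t : ℝ≥0∞) < lowerTime v c₂ c₃ σ ε (r + 1)) :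
    harmonicWork v c₃ (lowerTime v c₂ c₃ σ ε r) t <
      ENNReal.ofReal (max (c₂ * (σ ^ 2 / (n * ε))) 1) := by
  by_contra! hle
  rw [lowerTime] at ht
  exact ht.not_ge (sInf_le ⟨ENNReal.coe_ne_top, hle⟩)

/-- The number of stochastic gradients that worker `i` completes if it computes without
interruption from time `s` to time `t`. -/
def workCount (v : Fin n → ℝ≥0 → ℝ≥0) (s : ℝ≥0∞) (i : Fin n) (t : ℝ≥0) : ℕ :=
  ⌊(V (v i) t - V (v i) s).toReal⌋₊

/-- The supremum of the number of stochastic gradients that worker `i` completes if it computes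
without interruption from time `s` to some time before `s'`. -/
def maxWork (v : Fin n → ℝ≥0 → ℝ≥0) (s s' : ℝ≥0∞) (i : Fin n) : ℝ≥0∞ :=
  ⨆ t : {t : ℝ≥0 // (t : ℝ≥0∞) < s'}, (workCount v s i t : ℝ≥0∞)

lemma harmonicWork_one (s : ℝ≥0∞) (t : ℝ≥0) :
    harmonicWork v 1 s t = ((n : ℝ≥0∞)⁻¹ * ∑ i, (workCount v s i t : ℝ≥0∞)⁻¹)⁻¹ := by
  simp only [harmonicWork, workCount, one_mul]

lemma le_workCount {i : Fin n} {t : ℝ≥0} (hv : V (v i) t < ⊤) {m : ℕ}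
    (hm : (m : ℝ≥0∞) ≤ V (v i) t - V (v i) s) : m ≤ workCount v s i t :=
  Nat.le_floor (by simpa using ENNReal.toReal_mono (tsub_le_self.trans_lt hv).ne hm)

lemma workCount_mono {i : Fin n} (hv : ∀ t : ℝ≥0, V (v i) t < ⊤) :
    Monotone (workCount v s i) := fun _ t' h =>
  Nat.floor_le_floor <| ENNReal.toReal_mono (tsub_le_self.trans_lt (hv t')).ne <|
    tsub_le_tsub_right (V_mono _ (ENNReal.coe_le_coe.2 h)) _

lemma le_maxWork {s' : ℝ≥0∞} {i : Fin n} {t : ℝ≥0} (hv : V (v i) t < ⊤)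
    (ht : (t : ℝ≥0∞) < s') {m : ℕ} (hm : (m : ℝ≥0∞) ≤ V (v i) t - V (v i) s) :
    (m : ℝ≥0∞) ≤ maxWork v s s' i :=
  (Nat.cast_le.2 (le_workCount hv hm)).trans
    (le_iSup (fun t : {t : ℝ≥0 // (t : ℝ≥0∞) < s'} => (workCount v s i t : ℝ≥0∞)) ⟨t, ht⟩)

lemma one_le_harmonicWork_one (hn : 0 < n) {t : ℝ≥0} (h : ∀ i, 1 ≤ workCount v s i t) :
    1 ≤ harmonicWork v 1 s t := by
  rw [harmonicWork_one, ENNReal.one_le_inv]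
  calc (n : ℝ≥0∞)⁻¹ * ∑ i, (workCount v s i t : ℝ≥0∞)⁻¹
      ≤ (n : ℝ≥0∞)⁻¹ * ∑ _i : Fin n, 1 := by
        gcongr with i
        exact ENNReal.inv_le_one.2 (Nat.one_le_cast.2 (h i))
    _ = 1 := by
        simp [ENNReal.inv_mul_cancel, hn.ne']

lemma exists_forall_one_le_workCount (hn : 0 < n) (hv : ∀ i (t : ℝ≥0), V (v i) t < ⊤)
    {s' : ℝ≥0∞} (h : ∀ i, maxWork v s s' i ≠ 0) :
    ∃ t : ℝ≥0, (t : ℝ≥0∞) < s' ∧ ∀ i, 1 ≤ workCount v s i t := by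
  have : Nonempty (Fin n) := ⟨⟨0, hn⟩⟩
  have hex (i : Fin n) : ∃ t : ℝ≥0, (t : ℝ≥0∞) < s' ∧ 1 ≤ workCount v s i t := by
    simpa [maxWork, Nat.one_le_iff_ne_zero] using h i
  choose τ hτ hone using hex
  obtain ⟨i₁, hmax⟩ := Finite.exists_max τ
  exact ⟨τ i₁, hτ i₁, fun i => (hone i).trans (workCount_mono (hv i) (hmax i))⟩

lemma sum_inv_iSup_natCast {ι κ : Type*} [Fintype ι] [Preorder κ] [IsDirectedOrder κ]
    [Nonempty κ] {F : ι → κ → ℕ} (hF : ∀ i, Monotone (F i)) :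
    ∑ i, (⨆ t, (F i t : ℝ≥0∞))⁻¹ = ⨅ t, ∑ i, (F i t : ℝ≥0∞)⁻¹ := by
  have inv_anti (i : ι) {t t' : κ} (h : t ≤ t') : (F i t' : ℝ≥0∞)⁻¹ ≤ (F i t : ℝ≥0∞)⁻¹ :=
    ENNReal.inv_le_inv.2 (Nat.cast_le.2 (hF i h))
  simp only [ENNReal.inv_iSup]
  refine (ENNReal.iInf_sum fun _ t t' => ?_).symm
  obtain ⟨u, htu, htu'⟩ := exists_ge_ge t t'
  exact ⟨u, fun i _ => ⟨inv_anti i htu, inv_anti i htu'⟩⟩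

lemma inv_le_sum_inv_maxWork (hn : 0 < n) (hv : ∀ i (t : ℝ≥0), V (v i) t < ⊤) {s' b : ℝ≥0∞}
    (hs' : 0 < s') (h : ∀ t : ℝ≥0, (t : ℝ≥0∞) < s' → harmonicWork v 1 s t ≤ b) :
    b⁻¹ ≤ (n : ℝ≥0∞)⁻¹ * ∑ i, (maxWork v s s' i)⁻¹ := by
  have : Nonempty {t : ℝ≥0 // (t : ℝ≥0∞) < s'} := ⟨⟨0, hs'⟩⟩
  have hmono (i : Fin n) :
      Monotone fun t : {t : ℝ≥0 // (t : ℝ≥0∞) < s'} => workCount v s i t :=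
    fun _ _ htt' => workCount_mono (hv i) htt'
  simp only [maxWork]
  rw [sum_inv_iSup_natCast hmono,
    ENNReal.mul_iInf_of_ne (by simp) (by simpa using hn.ne')]
  refine le_iInf fun t => ENNReal.inv_le_iff_inv_le.1 ?_
  simpa only [← harmonicWork_one] using h t t.2

end Work

/-! ### Weights and success probabilities for one round -/

section Profile

variable {n : ℕ} {M : Fin n → ℝ≥0∞} {C σ : ℝ}

/-- Weights `w` of the workers and success probabilities `p` for one round in which worker `i` can
flip at most `M i` coins: the rescaled coin flips have variance at most `σ²`, and the expected
number of successes is at most `1/4`. -/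
structure IsProfile (M : Fin n → ℝ≥0∞) (C σ : ℝ) (w p : Fin n → ℝ) : Prop where
  sum_weight : ∑ i, w i = 1
  prob_nonneg : ∀ i, 0 ≤ p i
  prob_le_one : ∀ i, p i ≤ 1
  weight_eq_zero : ∀ i, p i = 0 → w i = 0
  variance : ∀ i, (n * w i * C) ^ 2 * (1 - p i) ≤ p i * σ ^ 2
  sum_prob_le : ∀ cnt : Fin n → ℕ, (∀ i, (cnt i : ℝ≥0∞) ≤ M i) → ∑ i, p i * cnt i ≤ 1 / 4

lemma isProfile_single (C σ : ℝ) {i₀ : Fin n} (h : M i₀ = 0) :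
    IsProfile M C σ (Pi.single i₀ 1) (Pi.single i₀ 1) where
  sum_weight := by simp
  prob_nonneg i := by by_cases hi : i = i₀ <;> simp [hi]
  prob_le_one i := by by_cases hi : i = i₀ <;> simp [hi]
  weight_eq_zero i hi := hi
  variance i := by
    by_cases hi : i = i₀
    · subst hi; simpa using sq_nonneg σ
    · simp [hi]
  sum_prob_le cnt hcnt := by
    have hzero : cnt i₀ = 0 := by simpa [h] using hcnt i₀
    rw [Finset.sum_eq_single i₀ (fun i _ hi => by simp [hi]) (by simp)]
    simp [hzero]

lemma sq_mul_one_sub_min_le (hσ : σ ≠ 0) (x : ℝ) :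
    x ^ 2 * (1 - min 1 ((x / σ) ^ 2)) ≤ min 1 ((x / σ) ^ 2) * σ ^ 2 := by
  rcases le_total 1 ((x / σ) ^ 2) with h | h
  · simpa [min_eq_left h] using sq_nonneg σ
  · rw [min_eq_right h, div_pow, div_mul_cancel₀ _ (by positivity)]
    exact mul_le_of_le_one_right (sq_nonneg x) (sub_le_self _ (by positivity))

lemma inv_toReal_mul_le_one {M : ℝ≥0∞} {m : ℕ} (h : (m : ℝ≥0∞) ≤ M) : M⁻¹.toReal * m ≤ 1 := by
  have hle : M⁻¹ * m ≤ 1 := (mul_le_mul_right h M⁻¹).trans (mul_comm M M⁻¹ ▸ M.mul_inv_le_one)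
  simpa using ENNReal.toReal_mono ENNReal.one_ne_top hle

/-- Weights proportional to `(M i)⁻¹`, the choice that balances the expected numbers of successes
of the workers. -/
def harmonicWeight (M : Fin n → ℝ≥0∞) (i : Fin n) : ℝ :=
  (M i)⁻¹.toReal / ∑ j, (M j)⁻¹.toReal

lemma sum_min_mul_le (hH : 0 < ∑ i, (M i)⁻¹.toReal)
    (h : 4 * (n * C / σ) ^ 2 ≤ ∑ i, (M i)⁻¹.toReal) {cnt : Fin n → ℕ}
    (hcnt : ∀ i, (cnt i : ℝ≥0∞) ≤ M i) :
    ∑ i, min 1 ((n * harmonicWeight M i * C / σ) ^ 2) * cnt i ≤ 1 / 4 := by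
  set H := ∑ i, (M i)⁻¹.toReal with hH_def
  have hterm (i : Fin n) : min 1 ((n * harmonicWeight M i * C / σ) ^ 2) * cnt i ≤
      (n * C / σ) ^ 2 / H ^ 2 * (M i)⁻¹.toReal :=
    calc min 1 ((n * harmonicWeight M i * C / σ) ^ 2) * cnt i
        ≤ (n * harmonicWeight M i * C / σ) ^ 2 * cnt i := by gcongr; exact min_le_right _ _
      _ = (n * C / σ) ^ 2 / H ^ 2 * (M i)⁻¹.toReal * ((M i)⁻¹.toReal * cnt i) := by
          rw [harmonicWeight, ← hH_def]; ring
      _ ≤ (n * C / σ) ^ 2 / H ^ 2 * (M i)⁻¹.toReal :=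
          mul_le_of_le_one_right (by positivity) (inv_toReal_mul_le_one (hcnt i))
  calc ∑ i, min 1 ((n * harmonicWeight M i * C / σ) ^ 2) * cnt i
      ≤ ∑ i, (n * C / σ) ^ 2 / H ^ 2 * (M i)⁻¹.toReal := Finset.sum_le_sum fun i _ => hterm i
    _ = (n * C / σ) ^ 2 / H := by rw [← Finset.mul_sum, ← hH_def]; field_simp
    _ ≤ 1 / 4 := by rw [div_le_iff₀ hH]; linarith

lemma isProfile_harmonicWeight (hn : 0 < n) (hC : C ≠ 0) (hσ : σ ≠ 0)
    (h : 4 * (n * C / σ) ^ 2 ≤ ∑ i, (M i)⁻¹.toReal) :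
    IsProfile M C σ (harmonicWeight M)
      (fun i => min 1 ((n * harmonicWeight M i * C / σ) ^ 2)) where
  sum_weight := by
    have hH : 0 < ∑ i, (M i)⁻¹.toReal := lt_of_lt_of_le (by positivity) h
    simp only [harmonicWeight]
    rw [← Finset.sum_div, div_self hH.ne']
  prob_nonneg i := le_min zero_le_one (sq_nonneg _)
  prob_le_one i := min_le_left _ _
  weight_eq_zero i hi := by
    have hsq : (n * harmonicWeight M i * C / σ) ^ 2 = 0 :=
      (min_choice 1 _).elim (fun h1 => absurd (h1.symm.trans hi) one_ne_zero) (· ▸ hi)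
    simpa [hn.ne', hC, hσ] using hsq
  variance i := sq_mul_one_sub_min_le hσ _
  sum_prob_le cnt hcnt := sum_min_mul_le (lt_of_lt_of_le (by positivity) h) h hcnt

lemma exists_isProfile_maxWork (hn : 0 < n) {v : Fin n → ℝ≥0 → ℝ≥0}
    (hv : ∀ i (t : ℝ≥0), V (v i) t < ⊤) {s s' : ℝ≥0∞} {B : ℝ} (hC : C ≠ 0)
    (hB : 4 * n * C ^ 2 * B ≤ σ ^ 2)
    (hwork : ∀ t : ℝ≥0, (t : ℝ≥0∞) < s' → harmonicWork v 1 s t < ENNReal.ofReal (max B 1)) :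
    ∃ w p, IsProfile (maxWork v s s') C σ w p := by
  by_cases hzero : ∃ i₀, maxWork v s s' i₀ = 0
  · obtain ⟨i₀, hi₀⟩ := hzero
    exact ⟨_, _, isProfile_single C σ hi₀⟩
  push Not at hzero
  obtain ⟨t₁, ht₁, hone⟩ := exists_forall_one_le_workCount hn hv hzero
  have hB_gt : 1 < B := by
    have := (one_le_harmonicWork_one hn hone).trans_lt (hwork t₁ ht₁)
    simpa using ENNReal.one_lt_ofReal.1 this
  have hσ : σ ≠ 0 := by
    rintro rfl
    have : 0 < 4 * n * C ^ 2 * B := by positivity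
    linarith
  have hinv_ne_top (i : Fin n) : (maxWork v s s' i)⁻¹ ≠ ⊤ := ENNReal.inv_ne_top.2 (hzero i)
  have hharmonic := ENNReal.toReal_mono
    (ENNReal.mul_ne_top (by simpa using hn.ne') (ENNReal.sum_ne_top.2 fun i _ => hinv_ne_top i))
    (inv_le_sum_inv_maxWork hn hv (pos_of_gt ht₁) fun t ht => (hwork t ht).le)
  rw [max_eq_left hB_gt.le, ENNReal.toReal_inv, ENNReal.toReal_ofReal (by positivity),
    ENNReal.toReal_mul, ENNReal.toReal_inv, ENNReal.toReal_natCast,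
    ENNReal.toReal_sum fun i _ => hinv_ne_top i] at hharmonic
  refine ⟨_, _, isProfile_harmonicWeight hn hC hσ ?_⟩
  calc 4 * (n * C / σ) ^ 2 ≤ n * B⁻¹ := by
        field_simp
        rw [div_le_one (by positivity)]
        exact hB
    _ ≤ n * ((n : ℝ)⁻¹ * ∑ i, (maxWork v s s' i)⁻¹.toReal) := by gcongr
    _ = ∑ i, (maxWork v s s' i)⁻¹.toReal := by field_simp

lemma exists_isProfile_lowerTime (hn : 0 < n) {v : Fin n → ℝ≥0 → ℝ≥0}
    (hv : ∀ i (t : ℝ≥0), V (v i) t < ⊤) {c₂ ε : ℝ} (hε : 0 < ε) (hC : C ≠ 0)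
    (hCε : 4 * c₂ * C ^ 2 ≤ ε) (r : ℕ) :
    ∃ w p, IsProfile (maxWork v (lowerTime v c₂ 1 σ ε r) (lowerTime v c₂ 1 σ ε (r + 1)))
      C σ w p := by
  refine exists_isProfile_maxWork hn hv hC ?_ fun t ht => harmonicWork_lt_of_lt ht
  calc 4 * n * C ^ 2 * (c₂ * (σ ^ 2 / (n * ε))) = 4 * c₂ * C ^ 2 * (σ ^ 2 / ε) := by field_simp
    _ ≤ ε * (σ ^ 2 / ε) := by gcongr
    _ = σ ^ 2 := by field_simp

end Profile

/-! ### The resisting oracle -/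

/-- The parameters of the resisting oracle: amplitude and length scale of the chain, weights and
success probabilities of the workers in every round, the times at which the rounds start, and the
number of the last round. -/
structure Resisting (n : ℕ) where
  amplitude : ℝ
  length : ℝ
  weight : ℕ → Fin n → ℝ
  prob : ℕ → Fin n → ℝ
  start : ℕ → ℝ≥0∞
  last : ℕ

/-- The round in which a time lies. -/
def Resisting.round {n : ℕ} (Z : Resisting n) (t : ℝ≥0) : ℕ :=
  open scoped Classical in Nat.findGreatest (fun r => Z.start r ≤ t) Z.last

namespace Resisting

variable {n : ℕ} (Z : Resisting n)

lemma round_le (t : ℝ≥0) : Z.round t ≤ Z.last := Nat.findGreatest_le _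

variable {Z}

lemma start_round_le (hZ : Z.start 0 = 0) (t : ℝ≥0) : Z.start (Z.round t) ≤ t :=
  open scoped Classical in
  Nat.findGreatest_spec (P := fun r => Z.start r ≤ t) (Nat.zero_le Z.last) (hZ ▸ zero_le)

lemma le_round {r : ℕ} {t : ℝ≥0} (hr : r ≤ Z.last) (ht : Z.start r ≤ t) : r ≤ Z.round t :=
  open scoped Classical in Nat.le_findGreatest hr ht

end Resisting

/-- The state of the simulated protocol after `k` iterations: the vectors received, the states of
the oracles, the number of coordinates found, and the rounds in which the links of the chain became
active. Link `j` becomes active when coordinate `j - 1` is found; its activation round is `0` before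
that, and link `0` is active from the start. -/
structure SimState (n d k : ℕ) where
  answers : Fin k → EuclideanSpace ℝ (Fin d)
  workers : Fin n → OracleState d
  found : ℕ
  activation : ℕ → ℕ

section Simulation

variable {n d : ℕ}

/-- The query that the algorithm issues in the state `S`. -/
abbrev SimState.query {k : ℕ} (S : SimState n d k) (A : Algorithm n d) : Query n d :=
  A k S.answers

/-- The state of the oracle that is called in the state `S`. -/
abbrev SimState.called {k : ℕ} (S : SimState n d k) (A : Algorithm n d) : OracleState d :=
  S.workers (S.query A).worker

/-- The round in which the active link, i.e. the one that hides the next coordinate, became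
active. -/
abbrev SimState.currentRound {k : ℕ} (S : SimState n d k) : ℕ := S.activation S.found

variable (Z : Resisting n) (v : Fin n → ℝ≥0 → ℝ≥0) (A : Algorithm n d)

/-- The query issued in the state `S` collects the result of a finished computation. -/
structure Completes {k : ℕ} (S : SimState n d k) : Prop where
  cancel_eq : (S.query A).cancel = false
  busy_eq : (S.called A).busy = true
  one_le_work : 1 ≤ V (v (S.query A).worker) (S.query A).time -
    V (v (S.query A).worker) (S.called A).time

/-- The local function of worker `i` if link `j` becomes active in round `R j`. -/
def localFun (R : ℕ → ℕ) (i : Fin n) : EuclideanSpace ℝ (Fin d) → ℝ :=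
  chainFun Z.amplitude Z.length fun j => n * Z.weight (R j) i

/-- The gradient of `localFun`. -/
def localGrad (R : ℕ → ℕ) (i : Fin n) (x : EuclideanSpace ℝ (Fin d)) :
    EuclideanSpace ℝ (Fin d) :=
  chainGrad Z.amplitude Z.length (fun j => n * Z.weight (R j) i) x

/-- The stochastic gradient: if `x` lies in the span of the first `m` coordinates, then coordinate
`m` of the gradient is shown, rescaled, only if the coin `b` succeeds. -/
def noisyGrad (m : ℕ) (R : ℕ → ℕ) (i : Fin n) (b : Prop) (x : EuclideanSpace ℝ (Fin d)) :
    EuclideanSpace ℝ (Fin d) :=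
  open scoped Classical in
  if SuppBelow m x then
    WithLp.toLp 2 fun c => if (c : ℕ) = m then
      (if b then (Z.prob (R m) i)⁻¹ * localGrad Z R i x c else 0) else localGrad Z R i x c
  else localGrad Z R i x

/-- The reply of the oracle to the query of the algorithm in the simulated protocol. -/
def simAnswer {k : ℕ} (S : SimState n d k) (b : Prop) :
    OracleState d × EuclideanSpace ℝ (Fin d) :=
  oracle (v (S.query A).worker)
    (fun x _ => noisyGrad Z S.found S.activation (S.query A).worker b x)
    (S.query A).time (S.query A).point (S.called A) (S.query A).cancel

/-- The answer to the query reveals the next coordinate. -/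
def Discovers {k : ℕ} (S : SimState n d k) (b : Prop) : Prop :=
  ∃ c : Fin d, (c : ℕ) = S.found ∧ (simAnswer Z v A S b).2 c ≠ 0

/-- One iteration of the simulated protocol with coin `b`. -/
def simStep {k : ℕ} (S : SimState n d k) (b : Prop) : SimState n d (k + 1) :=
  open scoped Classical in
  { answers := Fin.snoc S.answers (simAnswer Z v A S b).2
    workers := Function.update S.workers (S.query A).worker (simAnswer Z v A S b).1
    found := if Discovers Z v A S b then S.found + 1 else S.found
    activation := if Discovers Z v A S b then
      Function.update S.activation (S.found + 1) (Z.round (S.query A).time) else S.activation }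

/-- The success probability of the coin of the next iteration. -/
def coinProb {k : ℕ} (S : SimState n d k) : ℝ :=
  Z.prob S.currentRound (S.query A).worker

/-- The simulated protocol, with the coin of iteration `k` read off the uniform variable `ω k`. -/
def sim (ω : ℕ → unitInterval) : (k : ℕ) → SimState n d k
  | 0 => ⟨Fin.elim0, fun _ => idle d, 0, fun _ => 0⟩
  | k + 1 => simStep Z v A (sim ω k) ((ω k : ℝ) < coinProb Z A (sim ω k))

/-- The rounds in which the links become active in the whole run. -/
def finalRounds (ω : ℕ → unitInterval) (j : ℕ) : ℕ := ⨆ k, (sim Z v A ω k).activation j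

/-- The stochastic gradient mappings. The random element consists of the number of coordinates
found, the activation rounds, and a uniform variable. -/
def stochGrad (i : Fin n) (x : EuclideanSpace ℝ (Fin d))
    (ζ : (ℕ × (ℕ → ℕ)) × unitInterval) (_ : ℝ≥0) : EuclideanSpace ℝ (Fin d) :=
  noisyGrad Z ζ.1.1 ζ.1.2 i ((ζ.2 : ℝ) < Z.prob (ζ.1.2 ζ.1.1) i) x

/-- The random element of iteration `k`. It contains the activation rounds of the whole run, future
ones included: the stochastic gradients have to be those of the final local functions at every
point. -/
def randomElement (k : ℕ) (ω : ℕ → unitInterval) : (ℕ × (ℕ → ℕ)) × unitInterval :=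
  (((sim Z v A ω k).found, finalRounds Z v A ω), ω k)

/-- The invariants of the simulated protocol: everything produced so far is supported in the
coordinates found, and no later link is active. -/
structure SimInv {k : ℕ} (S : SimState n d k) : Prop where
  suppBelow_answers : ∀ j, SuppBelow S.found (S.answers j)
  suppBelow_workers : ∀ i, SuppBelow S.found (S.workers i).point
  activation_eq_zero : ∀ j, S.found < j → S.activation j = 0
  found_le : S.found ≤ d

variable {Z v A}

lemma gradient_localFun (R : ℕ → ℕ) (i : Fin n) (x : EuclideanSpace ℝ (Fin d)) :
    gradient (localFun Z R i) x = localGrad Z R i x := gradient_chainFun _ _ _ _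

lemma localGrad_congr {m : ℕ} {R R' : ℕ → ℕ} (i : Fin n) {x : EuclideanSpace ℝ (Fin d)}
    (hx : SuppBelow m x) (hR : ∀ j ≤ m, R j = R' j) :
    localGrad Z R i x = localGrad Z R' i x :=
  chainGrad_congr hx fun j hj => by rw [hR j hj]

lemma noisyGrad_congr {m : ℕ} {R R' : ℕ → ℕ} (i : Fin n) (b : Prop)
    {x : EuclideanSpace ℝ (Fin d)} (hx : SuppBelow m x) (hR : ∀ j ≤ m, R j = R' j) :
    noisyGrad Z m R i b x = noisyGrad Z m R' i b x := by
  simp only [noisyGrad, localGrad_congr i hx hR, hR m le_rfl]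

lemma suppBelow_noisyGrad {m : ℕ} {R : ℕ → ℕ} {i : Fin n} {b : Prop}
    {x : EuclideanSpace ℝ (Fin d)} (hx : SuppBelow m x) :
    SuppBelow (m + 1) (noisyGrad Z m R i b x) := by
  intro c hc
  have hne : (c : ℕ) ≠ m := by omega
  simp only [noisyGrad, if_pos hx, if_neg hne]
  exact chainGrad_apply_of_lt hx (by omega)

lemma of_noisyGrad_apply_ne_zero {m : ℕ} {R : ℕ → ℕ} {i : Fin n} {b : Prop}
    {x : EuclideanSpace ℝ (Fin d)} (hx : SuppBelow m x) {c : Fin d} (hc : (c : ℕ) = m)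
    (h : noisyGrad Z m R i b x c ≠ 0) : b ∧ chainVar Z.length x m ≠ 0 := by
  subst hc
  simp only [noisyGrad, if_pos hx, if_true] at h
  have hb : b := of_not_not fun hb => h (if_neg hb)
  refine ⟨hb, fun h0 => h ?_⟩
  rw [if_pos hb, localGrad, chainGrad_apply_frontier hx, h0, gate_zero]
  simp

section Oracle

variable (u : ℝ≥0 → ℝ≥0) (γ : EuclideanSpace ℝ (Fin d) → ℝ≥0 → EuclideanSpace ℝ (Fin d))
  (t : ℝ≥0) (x : EuclideanSpace ℝ (Fin d)) (s : OracleState d) (c : Bool)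

lemma oracle_fst_point :
    (oracle u γ t x s c).1.point = 0 ∨ (oracle u γ t x s c).1.point = x ∨
      (oracle u γ t x s c).1.point = s.point := by
  unfold oracle
  split_ifs <;> simp [idle]

lemma oracle_congr {γ γ' : EuclideanSpace ℝ (Fin d) → ℝ≥0 → EuclideanSpace ℝ (Fin d)}
    {s : OracleState d} (h : γ s.point t = γ' s.point t) :
    oracle u γ t x s c = oracle u γ' t x s c := by
  unfold oracle
  split_ifs <;> simp [h]

end Oracle

section Step

variable {k : ℕ} {S : SimState n d k} {b : Prop}

lemma simAnswer_of_completes (hS : Completes v A S) (b : Prop) :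
    simAnswer Z v A S b =
      (idle d, noisyGrad Z S.found S.activation (S.query A).worker b (S.called A).point) := by
  rw [simAnswer, oracle, if_neg (by simp [hS.cancel_eq]), if_neg (by simp [hS.busy_eq]),
    if_neg (not_lt.2 hS.one_le_work)]

lemma simAnswer_snd_of_not_completes (hS : ¬ Completes v A S) (b : Prop) :
    (simAnswer Z v A S b).2 = 0 := by
  unfold simAnswer oracle
  split_ifs with hcancel hbusy hwork
  · rfl
  · rfl
  · rfl
  · exact absurd ⟨by simpa using hcancel, by simpa using hbusy, not_lt.1 hwork⟩ hS

lemma SimInv.suppBelow_point (hS : SimInv S) (hA : IsZeroRespecting A) :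
    SuppBelow S.found (S.query A).point := by
  intro c hc
  by_contra hne
  obtain ⟨j, hj⟩ := hA.support k S.answers c hne
  exact hj (hS.suppBelow_answers j c hc)

lemma SimInv.suppBelow_simAnswer_snd (hS : SimInv S) (b : Prop) :
    SuppBelow (S.found + 1) (simAnswer Z v A S b).2 := by
  by_cases h : Completes v A S
  · rw [simAnswer_of_completes h]
    exact suppBelow_noisyGrad (hS.suppBelow_workers _)
  · rw [simAnswer_snd_of_not_completes h]
    exact suppBelow_zero _

lemma SimInv.suppBelow_simAnswer_snd_of_not_discovers (hS : SimInv S)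
    (hb : ¬ Discovers Z v A S b) : SuppBelow S.found (simAnswer Z v A S b).2 := by
  intro c hc
  rcases hc.eq_or_lt with h | h
  · exact of_not_not fun hne => hb ⟨c, h.symm, hne⟩
  · exact hS.suppBelow_simAnswer_snd b c h

lemma SimInv.suppBelow_simAnswer_fst_point (hS : SimInv S) (hA : IsZeroRespecting A)
    (b : Prop) : SuppBelow S.found (simAnswer Z v A S b).1.point := by
  rw [simAnswer]
  rcases oracle_fst_point (v (S.query A).worker)
    (fun x _ => noisyGrad Z S.found S.activation (S.query A).worker b x)
    (S.query A).time (S.query A).point (S.called A) (S.query A).cancel with h | h | h <;> rw [h]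
  · exact suppBelow_zero _
  · exact hS.suppBelow_point hA
  · exact hS.suppBelow_workers _

lemma found_le_simStep (S : SimState n d k) (b : Prop) :
    S.found ≤ (simStep Z v A S b).found := by
  unfold simStep
  split_ifs <;> simp

lemma simStep_activation_of_le (S : SimState n d k) (b : Prop) {j : ℕ} (hj : j ≤ S.found) :
    (simStep Z v A S b).activation j = S.activation j := by
  unfold simStep
  split_ifs
  · exact Function.update_of_ne (by omega) _ _
  · rfl

lemma SimInv.suppBelow_simStep_answers (hS : SimInv S) (b : Prop) (j : Fin (k + 1)) :
    SuppBelow (simStep Z v A S b).found ((simStep Z v A S b).answers j) := by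
  have hle := found_le_simStep (Z := Z) (v := v) (A := A) S b
  induction j using Fin.lastCases with
  | last =>
    by_cases hd : Discovers Z v A S b
    · simpa [simStep, hd] using hS.suppBelow_simAnswer_snd b
    · simpa [simStep, hd] using hS.suppBelow_simAnswer_snd_of_not_discovers hd
  | cast j => simpa [simStep] using (hS.suppBelow_answers j).mono hle

lemma SimInv.suppBelow_simStep_workers (hS : SimInv S) (hA : IsZeroRespecting A) (b : Prop)
    (i : Fin n) : SuppBelow (simStep Z v A S b).found ((simStep Z v A S b).workers i).point := by
  refine SuppBelow.mono (found_le_simStep S b) ?_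
  by_cases hi : i = (S.query A).worker
  · simpa [simStep, hi] using hS.suppBelow_simAnswer_fst_point hA b
  · simpa [simStep, hi] using hS.suppBelow_workers i

lemma SimInv.simStep (hS : SimInv S) (hA : IsZeroRespecting A) (b : Prop) :
    SimInv (simStep Z v A S b) where
  suppBelow_answers := hS.suppBelow_simStep_answers b
  suppBelow_workers := hS.suppBelow_simStep_workers hA b
  activation_eq_zero j hj := by
    by_cases hd : Discovers Z v A S b
    · simp only [TimeOracle.simStep, hd, if_true] at hj ⊢
      rw [Function.update_of_ne (by omega)]
      exact hS.activation_eq_zero j (by omega)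
    · simp only [TimeOracle.simStep, hd, if_false] at hj ⊢
      exact hS.activation_eq_zero j hj
  found_le := by
    by_cases hd : Discovers Z v A S b
    · obtain ⟨c, hc, -⟩ := id hd
      simp only [TimeOracle.simStep, hd, if_true]
      omega
    · simp only [TimeOracle.simStep, hd, if_false]
      exact hS.found_le

end Step

lemma simInv_sim (hA : IsZeroRespecting A) (ω : ℕ → unitInterval) (k : ℕ) :
    SimInv (sim Z v A ω k) := by
  induction k with
  | zero => exact ⟨fun j => j.elim0, fun _ => suppBelow_zero _, fun _ _ => rfl, Nat.zero_le _⟩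
  | succ k ih => exact ih.simStep hA _

lemma sim_found_mono (ω : ℕ → unitInterval) : Monotone fun k => (sim Z v A ω k).found :=
  monotone_nat_of_le_succ fun _ => found_le_simStep _ _

lemma sim_activation_of_le (ω : ℕ → unitInterval) {k l : ℕ} (hkl : k ≤ l) {j : ℕ}
    (hj : j ≤ (sim Z v A ω k).found) :
    (sim Z v A ω l).activation j = (sim Z v A ω k).activation j := by
  induction l, hkl using Nat.le_induction with
  | base => rfl
  | succ l hkl ih =>
    rw [← ih]
    exact simStep_activation_of_le _ _ (hj.trans (sim_found_mono ω hkl))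

lemma finalRounds_eq (hA : IsZeroRespecting A) (ω : ℕ → unitInterval) {k j : ℕ}
    (hj : j ≤ (sim Z v A ω k).found) :
    finalRounds Z v A ω j = (sim Z v A ω k).activation j := by
  have hle (l : ℕ) : (sim Z v A ω l).activation j ≤ (sim Z v A ω k).activation j := by
    rcases le_total k l with hkl | hlk
    · rw [sim_activation_of_le ω hkl hj]
    · by_cases hjl : j ≤ (sim Z v A ω l).found
      · rw [sim_activation_of_le ω hlk hjl]
      · rw [(simInv_sim hA ω l).activation_eq_zero j (not_le.1 hjl)]
        exact Nat.zero_le _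
  exact le_antisymm (ciSup_le hle)
    (le_ciSup (f := fun l => (sim Z v A ω l).activation j) ⟨_, Set.forall_mem_range.2 hle⟩ k)

lemma oracle_realize_eq_simAnswer (hA : IsZeroRespecting A) (ω : ℕ → unitInterval) (k : ℕ) :
    let S := sim Z v A ω k
    oracle (v (S.query A).worker)
        (realize (stochGrad Z) (randomElement Z v A) ω k (S.query A).worker)
        (S.query A).time (S.query A).point (S.called A) (S.query A).cancel =
      simAnswer Z v A S ((ω k : ℝ) < coinProb Z A S) := by
  intro S
  have hrounds (j : ℕ) (hj : j ≤ S.found) : finalRounds Z v A ω j = S.activation j :=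
    finalRounds_eq hA ω hj
  refine oracle_congr _ _ _ _ ?_
  simp only [realize, stochGrad, randomElement, coinProb]
  rw [hrounds _ le_rfl]
  exact noisyGrad_congr _ _ ((simInv_sim hA ω k).suppBelow_workers _) hrounds

lemma run_eq_sim (hA : IsZeroRespecting A) (ω : ℕ → unitInterval) (k : ℕ) :
    run v A (realize (stochGrad Z) (randomElement Z v A) ω) k =
      ((sim Z v A ω k).answers, (sim Z v A ω k).workers) := by
  induction k with
  | zero => rfl
  | succ k ih =>
    simp only [run, ih, sim, simStep]
    rw [← oracle_realize_eq_simAnswer hA]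

lemma transcript_eq_sim (hA : IsZeroRespecting A) (ω : ℕ → unitInterval) (k : ℕ) :
    transcript v A (realize (stochGrad Z) (randomElement Z v A) ω) k =
      (sim Z v A ω k).answers := by
  rw [transcript, run_eq_sim hA]

lemma iterate_eq_sim (hA : IsZeroRespecting A) (ω : ℕ → unitInterval) (k : ℕ) :
    iterate v A (realize (stochGrad Z) (randomElement Z v A) ω) k =
      ((sim Z v A ω k).query A).point := by
  rw [iterate, transcript_eq_sim hA]

lemma sim_activation_le (ω : ℕ → unitInterval) (k j : ℕ) :
    (sim Z v A ω k).activation j ≤ Z.last := by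
  induction k with
  | zero => exact Nat.zero_le _
  | succ k ih =>
    simp only [sim, simStep]
    split_ifs
    · by_cases hj : j = (sim Z v A ω k).found + 1
      · subst hj; simpa using Z.round_le _
      · simpa [Function.update_of_ne hj] using ih
    · exact ih

lemma finalRounds_le (ω : ℕ → unitInterval) (j : ℕ) :
    finalRounds Z v A ω j ≤ Z.last := ciSup_le fun k => sim_activation_le ω k j

lemma finalRounds_eq_zero (hA : IsZeroRespecting A) (ω : ℕ → unitInterval) {j : ℕ} (hj : d < j) :
    finalRounds Z v A ω j = 0 :=
  Nat.le_zero.1 (ciSup_le fun k => ((simInv_sim hA ω k).activation_eq_zero j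
    ((simInv_sim hA ω k).found_le.trans_lt hj)).le)

lemma finite_range_finalRounds (hA : IsZeroRespecting A) :
    (Set.range (finalRounds Z v A)).Finite := by
  refine (Set.finite_range (fun (ρ : Fin (d + 1) → Fin (Z.last + 1)) (j : ℕ) =>
    if h : j < d + 1 then (ρ ⟨j, h⟩ : ℕ) else 0)).subset ?_
  rintro _ ⟨ω, rfl⟩
  refine ⟨fun j => ⟨finalRounds Z v A ω j, Nat.lt_succ_of_le (finalRounds_le ω j)⟩, ?_⟩
  funext j
  by_cases h : j < d + 1
  · simp [h]
  · simp [h, finalRounds_eq_zero hA ω (show d < j by omega)]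

end Simulation

/-! ### Maps with finitely many values -/

/-- A map with finite range all of whose preimages are measurable, so that no σ-algebra on the
codomain is needed. -/
structure IsSimpleMap {Ω α : Type*} (m : MeasurableSpace Ω) (T : Ω → α) : Prop where
  finite_range : (Set.range T).Finite
  measurableSet : ∀ B : Set α, MeasurableSet[m] (T ⁻¹' B)

namespace IsSimpleMap

variable {Ω α β : Type*} {m : MeasurableSpace Ω}

lemma of_singleton {T : Ω → α} (h : (Set.range T).Finite)
    (hT : ∀ a, MeasurableSet[m] (T ⁻¹' {a})) : IsSimpleMap m T := by
  refine ⟨h, fun B => ?_⟩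
  have hunion : T ⁻¹' B = ⋃ a ∈ Set.range T ∩ B, T ⁻¹' {a} := by
    ext ω
    simp
  rw [hunion]
  exact (h.inter_of_left B).measurableSet_biUnion fun a _ => hT a

lemma of_prop {p : Ω → Prop} (hp : MeasurableSet[m] {ω | p ω}) : IsSimpleMap m p :=
  ⟨Set.toFinite _, fun _ => measurableSet_setOfPred.1 hp trivial⟩

lemma const (a : α) : IsSimpleMap m fun _ => a :=
  ⟨(Set.finite_singleton a).subset Set.range_const_subset, fun B => MeasurableSet.const (a ∈ B)⟩

lemma mono {m' : MeasurableSpace Ω} (h : m ≤ m') {T : Ω → α} (hT : IsSimpleMap m T) :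
    IsSimpleMap m' T :=
  ⟨hT.finite_range, fun B => h _ (hT.measurableSet B)⟩

lemma comp {T : Ω → α} (hT : IsSimpleMap m T) (y : α → β) : IsSimpleMap m fun ω => y (T ω) :=
  ⟨(hT.finite_range.image y).subset (Set.range_comp y T).subset,
    fun B => hT.measurableSet (y ⁻¹' B)⟩

lemma prodMk {T : Ω → α} {T' : Ω → β} (hT : IsSimpleMap m T) (hT' : IsSimpleMap m T') :
    IsSimpleMap m fun ω => (T ω, T' ω) := by
  refine of_singleton ((hT.finite_range.prod hT'.finite_range).subset ?_) fun a => ?_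
  · rintro _ ⟨ω, rfl⟩
    exact ⟨⟨ω, rfl⟩, ⟨ω, rfl⟩⟩
  · have hinter : (fun ω => (T ω, T' ω)) ⁻¹' {a} = T ⁻¹' {a.1} ∩ T' ⁻¹' {a.2} := by
      ext ω
      simp [Prod.ext_iff]
    rw [hinter]
    exact (hT.measurableSet _).inter (hT'.measurableSet _)

lemma measurable {T : Ω → α} (hT : IsSimpleMap m T) [MeasurableSpace α] : Measurable T :=
  fun B _ => hT.measurableSet B

variable {F : Type*} [NormedAddCommGroup F] {μ : Measure Ω}

lemma integrable {T : Ω → F} (hT : IsSimpleMap m T) (μ : Measure Ω) [IsFiniteMeasure μ] :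
    Integrable T μ :=
  SimpleFunc.integrable_of_isFiniteMeasure
    (⟨T, fun a => hT.measurableSet {a}, hT.finite_range⟩ : SimpleFunc Ω F)

variable [NormedSpace ℝ F]

lemma integral_eq_sum {T : Ω → α} (hT : IsSimpleMap m T) {f : Ω → F} (hf : Integrable f μ) :
    ∫ ω, f ω ∂μ = ∑ a ∈ hT.finite_range.toFinset, ∫ ω in T ⁻¹' {a}, f ω ∂μ := by
  have huniv : ⋃ a ∈ hT.finite_range.toFinset, T ⁻¹' {a} = Set.univ :=
    Set.eq_univ_of_forall fun ω => by simp
  rw [← integral_biUnion_finset _ (fun a _ => hT.measurableSet {a})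
    (fun a _ b _ hab => (Set.disjoint_singleton.2 hab).preimage T) (fun _ _ => hf.integrableOn),
    huniv, setIntegral_univ]

lemma integral_congr_fibers {T : Ω → α} (hT : IsSimpleMap m T) {f g : Ω → F}
    (hf : Integrable f μ) (hg : Integrable g μ)
    (h : ∀ a, ∫ ω in T ⁻¹' {a}, f ω ∂μ = ∫ ω in T ⁻¹' {a}, g ω ∂μ) :
    ∫ ω, f ω ∂μ = ∫ ω, g ω ∂μ := by
  rw [hT.integral_eq_sum hf, hT.integral_eq_sum hg]
  exact Finset.sum_congr rfl fun a _ => h a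

end IsSimpleMap

/-! ### Independent coins -/

/-- The law of a sequence of independent uniform variables. -/
def uniformSeq : Measure (ℕ → unitInterval) := Measure.infinitePi fun _ => volume

instance : IsProbabilityMeasure uniformSeq := by
  unfold uniformSeq; infer_instance

/-- The σ-algebra generated by the coordinates before `k`. -/
@[reducible]
def coordsBefore (k : ℕ) : MeasurableSpace (ℕ → unitInterval) :=
  ⨆ i ∈ Set.Iio k, MeasurableSpace.comap (fun ω : ℕ → unitInterval => ω i) inferInstance

lemma coordsBefore_mono {k l : ℕ} (h : k ≤ l) : coordsBefore k ≤ coordsBefore l :=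
  biSup_mono fun _ hi => lt_of_lt_of_le hi h

lemma coordsBefore_le (k : ℕ) : coordsBefore k ≤ MeasurableSpace.pi :=
  iSup₂_le fun i _ => (measurable_pi_apply i).comap_le

lemma measurable_coord (k : ℕ) :
    Measurable[coordsBefore (k + 1)] fun ω : ℕ → unitInterval => ω k := by
  rw [measurable_iff_comap_le]
  exact le_iSup₂_of_le k (Set.mem_Iio.2 (Nat.lt_succ_self k)) le_rfl

lemma indep_coordsBefore (k : ℕ) :
    ProbabilityTheory.Indep (coordsBefore k)
      (MeasurableSpace.comap (fun ω : ℕ → unitInterval => ω k) inferInstance) uniformSeq := by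
  have hcoords := ProbabilityTheory.iIndepFun_infinitePi
    (P := fun _ : ℕ => (volume : Measure unitInterval))
    (X := fun _ u => u) (fun _ => measurable_id)
  simpa only [Set.mem_singleton_iff, iSup_iSup_eq_left, coordsBefore, uniformSeq] using
    ProbabilityTheory.indep_iSup_of_disjoint (fun i => (measurable_pi_apply i).comap_le) hcoords
      (S := Set.Iio k) (T := {k}) (by simp)

lemma uniformSeq_coord_lt (k : ℕ) (p : unitInterval) :
    uniformSeq.real {ω | ω k < p} = p := by
  have h := (measurePreserving_eval_infinitePi
    (fun _ : ℕ => (volume : Measure unitInterval)) k).measure_preimage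
    (measurableSet_Iio (a := p)).nullMeasurableSet
  rw [unitInterval.volume_Iio] at h
  rw [measureReal_def]
  exact (congrArg ENNReal.toReal h).trans (ENNReal.toReal_ofReal p.2.1)

lemma uniformSeq_inter_coord_lt {k : ℕ} {s : Set (ℕ → unitInterval)}
    (hs : MeasurableSet[coordsBefore k] s) (p : unitInterval) :
    uniformSeq.real (s ∩ {ω | ω k < p}) = uniformSeq.real s * p := by
  have h := (ProbabilityTheory.Indep_iff _ _ _).1 (indep_coordsBefore k) s {ω | ω k < p} hs
    ⟨Set.Iio p, measurableSet_Iio, rfl⟩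
  rw [measureReal_def, h, ENNReal.toReal_mul, ← measureReal_def, ← measureReal_def,
    uniformSeq_coord_lt]

lemma isSimpleMap_coin {α β : Type*} {k : ℕ} {T : (ℕ → unitInterval) → α}
    (hT : IsSimpleMap (coordsBefore k) T) (h : α → Prop → β) (p : α → ℝ) :
    IsSimpleMap (coordsBefore (k + 1)) fun ω => h (T ω) ((ω k : ℝ) < p (T ω)) := by
  have hT' : IsSimpleMap (coordsBefore (k + 1)) T := hT.mono (coordsBefore_mono k.le_succ)
  have hcoin : IsSimpleMap (coordsBefore (k + 1)) fun ω => (ω k : ℝ) < p (T ω) :=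
    .of_prop (measurableSet_lt (measurable_subtype_coe.comp (measurable_coord k))
      (hT'.comp p).measurable)
  exact (hT'.prodMk hcoin).comp fun y => h y.1 y.2

section Coin

variable {F : Type*} [NormedAddCommGroup F] [NormedSpace ℝ F] [CompleteSpace F] {k : ℕ}

lemma setIntegral_coin {s : Set (ℕ → unitInterval)} (hs : MeasurableSet[coordsBefore k] s)
    (h : Prop → F) {p : ℝ} (hp : p ∈ unitInterval) :
    ∫ ω in s, h ((ω k : ℝ) < p) ∂uniformSeq =
      ∫ _ in s, (p • h True + (1 - p) • h False) ∂uniformSeq := by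
  set E : Set (ℕ → unitInterval) := {ω | ω k < (⟨p, hp⟩ : unitInterval)}
  have hEm : MeasurableSet E := measurableSet_lt (measurable_pi_apply k) measurable_const
  have hdecomp (ω : ℕ → unitInterval) : h ((ω k : ℝ) < p) =
      h False + E.indicator (fun _ => h True - h False) ω := by
    by_cases hω : (ω k : ℝ) < p
    · rw [Set.indicator_of_mem (show ω ∈ E from hω), eq_true hω, add_sub_cancel]
    · rw [Set.indicator_of_notMem (show ω ∉ E from hω), eq_false hω, add_zero]
  simp only [hdecomp]
  rw [integral_add (integrable_const _) ((integrable_const _).indicator hEm),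
    setIntegral_indicator hEm, setIntegral_const, setIntegral_const, setIntegral_const,
    uniformSeq_inter_coord_lt hs]
  module

lemma integral_coin {α : Type*} {T : (ℕ → unitInterval) → α}
    (hT : IsSimpleMap (coordsBefore k) T) (h : α → Prop → F) {p : α → ℝ}
    (hp : ∀ a, p a ∈ unitInterval) :
    ∫ ω, h (T ω) ((ω k : ℝ) < p (T ω)) ∂uniformSeq =
      ∫ ω, (p (T ω) • h (T ω) True + (1 - p (T ω)) • h (T ω) False) ∂uniformSeq := by
  have hT' : IsSimpleMap MeasurableSpace.pi T := hT.mono (coordsBefore_le k)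
  refine hT'.integral_congr_fibers
    (((isSimpleMap_coin hT h p).mono (coordsBefore_le _)).integrable _)
    ((hT'.comp fun a => p a • h a True + (1 - p a) • h a False).integrable _) fun a => ?_
  have hfiber : MeasurableSet (T ⁻¹' {a}) := hT'.measurableSet {a}
  calc ∫ ω in T ⁻¹' {a}, h (T ω) ((ω k : ℝ) < p (T ω)) ∂uniformSeq
      = ∫ ω in T ⁻¹' {a}, h a ((ω k : ℝ) < p a) ∂uniformSeq :=
        setIntegral_congr_fun hfiber fun ω hω => by simp only [show T ω = a from hω]
    _ = ∫ _ in T ⁻¹' {a}, (p a • h a True + (1 - p a) • h a False) ∂uniformSeq :=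
        setIntegral_coin (hT.measurableSet {a}) (h a) (hp a)
    _ = ∫ ω in T ⁻¹' {a}, (p (T ω) • h (T ω) True + (1 - p (T ω)) • h (T ω) False)
          ∂uniformSeq :=
        setIntegral_congr_fun hfiber fun ω hω => by simp only [show T ω = a from hω]

end Coin

section SimulationMeasurability

variable {n d : ℕ} {Z : Resisting n} {v : Fin n → ℝ≥0 → ℝ≥0} {A : Algorithm n d}

lemma isSimpleMap_sim_coordsBefore (k : ℕ) :
    IsSimpleMap (coordsBefore k) fun ω => sim Z v A ω k := by
  induction k with
  | zero => exact .const _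
  | succ k ih => exact isSimpleMap_coin ih (simStep Z v A) (coinProb Z A)

lemma isSimpleMap_sim (k : ℕ) : IsSimpleMap MeasurableSpace.pi fun ω => sim Z v A ω k :=
  (isSimpleMap_sim_coordsBefore k).mono (coordsBefore_le k)

lemma isSimpleMap_finalRounds (hA : IsZeroRespecting A) :
    IsSimpleMap MeasurableSpace.pi (finalRounds Z v A) := by
  have hm : Measurable (finalRounds Z v A) := measurable_pi_lambda _ fun j =>
    .iSup fun k => ((isSimpleMap_sim k).comp fun S => S.activation j).measurable
  exact .of_singleton (finite_range_finalRounds hA) fun R => hm (measurableSet_singleton R)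

end SimulationMeasurability

/-! ### Conditional expectations of coins -/

lemma condExp_le_const_of_forall_setIntegral_le {Ω : Type*} {m mΩ : MeasurableSpace Ω}
    {μ : Measure Ω} [IsFiniteMeasure μ] (hm : m ≤ mΩ) {q : Ω → ℝ} (hq : Integrable q μ) {C : ℝ}
    (h : ∀ s, MeasurableSet[m] s → ∫ ω in s, q ω ∂μ ≤ ∫ _ in s, C ∂μ) :
    μ[q | m] ≤ᵐ[μ] fun _ => C := by
  refine ae_le_of_ae_le_trim (hm := hm) ?_
  refine ae_le_of_forall_setIntegral_le
    (integrable_condExp.trim hm stronglyMeasurable_condExp) (integrable_const C) fun s hs _ => ?_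
  rw [← setIntegral_trim hm stronglyMeasurable_condExp hs,
    ← setIntegral_trim hm stronglyMeasurable_const hs, setIntegral_condExp hm hq hs]
  exact h s hs

/-- The σ-algebra of the events that are determined by `T` as long as `T` lies in `N`. -/
@[reducible]
def determinedOn {Ω α : Type*} (T : Ω → α) (N : Set α) : MeasurableSpace Ω :=
  MeasurableSpace.map (Subtype.val : T ⁻¹' N → Ω)
    (MeasurableSpace.comap (fun ω : T ⁻¹' N => T ω) ⊤)

section Determined

variable {Ω α F : Type*} {T : Ω → α} {N : Set α}

lemma exists_mem_iff_of_determinedOn {s : Set Ω} (hs : MeasurableSet[determinedOn T N] s) :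
    ∃ B : Set α, ∀ ω, T ω ∈ N → (ω ∈ s ↔ T ω ∈ B) := by
  obtain ⟨B, -, hB⟩ := hs
  exact ⟨B, fun ω hω => (Set.ext_iff.1 hB ⟨ω, hω⟩).symm⟩

lemma comap_le_determinedOn [mF : MeasurableSpace F] {φ : Ω → F} (y : α → F)
    (h : ∀ ω, T ω ∈ N → φ ω = y (T ω)) : mF.comap φ ≤ determinedOn T N := by
  rintro _ ⟨U, -, rfl⟩
  refine ⟨y ⁻¹' U, trivial, ?_⟩
  ext ω
  simp [h ω.1 ω.2]

end Determined

section ConditionalCoin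

variable {α F : Type*} [NormedAddCommGroup F] [NormedSpace ℝ F] [CompleteSpace F] {k : ℕ}
  {T : (ℕ → unitInterval) → α} {N : Set α} {p : α → ℝ}

lemma setIntegral_coin_of_determinedOn (hT : IsSimpleMap (coordsBefore k) T)
    {h : α → Prop → F} (h0 : ∀ a ∉ N, ∀ b, h a b = 0) (hp : ∀ a, p a ∈ unitInterval)
    {s : Set (ℕ → unitInterval)} (hs : MeasurableSet s)
    (hdet : MeasurableSet[determinedOn T N] s) :
    ∫ ω in s, h (T ω) ((ω k : ℝ) < p (T ω)) ∂uniformSeq =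
      ∫ ω in s, (p (T ω) • h (T ω) True + (1 - p (T ω)) • h (T ω) False) ∂uniformSeq := by
  classical
  obtain ⟨B, hB⟩ := exists_mem_iff_of_determinedOn hdet
  set hB' : α → Prop → F := fun a b => if a ∈ B then h a b else 0 with hB'_def
  have hind (f : α → (ℕ → unitInterval) → F) (hf : ∀ a ∉ N, ∀ ω, f a ω = 0)
      (ω : ℕ → unitInterval) :
      s.indicator (fun ω => f (T ω) ω) ω = if T ω ∈ B then f (T ω) ω else 0 := by
    by_cases hω : T ω ∈ N
    · simp only [Set.indicator, hB ω hω]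
    · simp [Set.indicator, hf _ hω]
  rw [← integral_indicator hs, ← integral_indicator hs]
  calc _ = ∫ ω, hB' (T ω) ((ω k : ℝ) < p (T ω)) ∂uniformSeq :=
        integral_congr_ae (.of_forall
          (hind (fun a ω => h a ((ω k : ℝ) < p a)) fun a ha ω => h0 a ha _))
    _ = ∫ ω, (p (T ω) • hB' (T ω) True + (1 - p (T ω)) • hB' (T ω) False) ∂uniformSeq :=
        integral_coin hT hB' hp
    _ = _ := integral_congr_ae (.of_forall fun ω => by
        rw [hind (fun a _ => p a • h a True + (1 - p a) • h a False)
          fun a ha _ => by simp [h0 a ha]]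
        by_cases hω : T ω ∈ B <;> simp [hB'_def, hω])

lemma condExp_add_coin {m : MeasurableSpace (ℕ → unitInterval)}
    (hT : IsSimpleMap (coordsBefore k) T) (hm : m ≤ MeasurableSpace.pi)
    (hmT : m ≤ determinedOn T N) {D : (ℕ → unitInterval) → F} (hD : StronglyMeasurable[m] D)
    (hDint : Integrable D uniformSeq) {h : α → Prop → F} (h0 : ∀ a ∉ N, ∀ b, h a b = 0)
    (hp : ∀ a, p a ∈ unitInterval) (hmean : ∀ a, p a • h a True + (1 - p a) • h a False = 0) :
    uniformSeq[D + fun ω => h (T ω) ((ω k : ℝ) < p (T ω)) | m] =ᵐ[uniformSeq] D := by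
  have hint : Integrable (fun ω => h (T ω) ((ω k : ℝ) < p (T ω))) uniformSeq :=
    ((isSimpleMap_coin hT h p).mono (coordsBefore_le _)).integrable _
  refine (ae_eq_condExp_of_forall_setIntegral_eq hm (hDint.add hint)
    (fun _ _ _ => hDint.integrableOn) (fun s hs _ => ?_) hD.aestronglyMeasurable).symm
  simp only [Pi.add_apply]
  rw [integral_add hDint.integrableOn hint.integrableOn,
    setIntegral_coin_of_determinedOn hT h0 hp (hm s hs) (hmT s hs)]
  simp only [hmean, integral_zero, add_zero]

lemma condExp_coin_le {m : MeasurableSpace (ℕ → unitInterval)}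
    (hT : IsSimpleMap (coordsBefore k) T) (hm : m ≤ MeasurableSpace.pi)
    (hmT : m ≤ determinedOn T N) {h : α → Prop → ℝ} (h0 : ∀ a ∉ N, ∀ b, h a b = 0)
    (hp : ∀ a, p a ∈ unitInterval) {C : ℝ}
    (hmean : ∀ a, p a * h a True + (1 - p a) * h a False ≤ C) :
    uniformSeq[fun ω => h (T ω) ((ω k : ℝ) < p (T ω)) | m] ≤ᵐ[uniformSeq] fun _ => C := by
  refine condExp_le_const_of_forall_setIntegral_le hm
    (((isSimpleMap_coin hT h p).mono (coordsBefore_le _)).integrable _) fun s hs => ?_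
  rw [setIntegral_coin_of_determinedOn hT h0 hp (hm s hs) (hmT s hs)]
  exact setIntegral_mono
    (((hT.mono (coordsBefore_le k)).comp fun a => p a * h a True + (1 - p a) * h a False).integrable
      uniformSeq).integrableOn (integrable_const C).integrableOn fun ω => hmean _

end ConditionalCoin

/-! ### The error of the stochastic gradients -/

section GradError

variable {n d : ℕ} (Z : Resisting n) (m : ℕ) (R : ℕ → ℕ) (i : Fin n)
  (x : EuclideanSpace ℝ (Fin d))

/-- The part of the gradient in coordinate `m`. -/
def frontierPart : EuclideanSpace ℝ (Fin d) :=
  WithLp.toLp 2 fun c => if (c : ℕ) = m then localGrad Z R i x c else 0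

/-- The error of the stochastic gradient with coin `b`. -/
def gradError (b : Prop) : EuclideanSpace ℝ (Fin d) :=
  open scoped Classical in
  if SuppBelow m x then
    (if b then (Z.prob (R m) i)⁻¹ - 1 else -1) • frontierPart Z m R i x
  else 0

lemma noisyGrad_sub_localGrad (b : Prop) :
    noisyGrad Z m R i b x - localGrad Z R i x = gradError Z m R i x b := by
  classical
  unfold noisyGrad gradError
  split_ifs with h hb
  · ext c
    by_cases hc : (c : ℕ) = m <;> simp [frontierPart, hc, sub_mul]
  · ext c
    by_cases hc : (c : ℕ) = m <;> simp [frontierPart, hc]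
  · simp

variable {Z m R i x}

lemma gradError_congr {R' : ℕ → ℕ} (hR : ∀ j ≤ m, R j = R' j) (b : Prop) :
    gradError Z m R i x b = gradError Z m R' i x b := by
  by_cases hx : SuppBelow m x
  · simp only [gradError, frontierPart, localGrad_congr i hx hR, hR m le_rfl]
  · simp only [gradError, if_neg hx]

lemma norm_sq_frontierPart_le (hx : SuppBelow m x) :
    ‖frontierPart Z m R i x‖ ^ 2 ≤
      (n * Z.weight (R m) i * (Z.amplitude * Z.length⁻¹)) ^ 2 := by
  have hcoord (c : Fin d) (hc : (c : ℕ) ≠ m) : ‖frontierPart Z m R i x c‖ ^ 2 = 0 := by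
    simp [frontierPart, hc]
  rw [EuclideanSpace.norm_sq_eq]
  by_cases hm : m < d
  · have hgate : gate (chainVar Z.length x m) ^ 2 ≤ 1 :=
      pow_le_one₀ (gate_nonneg _) (gate_le_one _)
    rw [Finset.sum_eq_single_of_mem (⟨m, hm⟩ : Fin d) (Finset.mem_univ _)
      fun c _ hc => hcoord c fun h => hc (Fin.ext h)]
    simp only [frontierPart, if_true, localGrad]
    rw [chainGrad_apply_frontier (c := ⟨m, hm⟩) hx, norm_neg, Real.norm_eq_abs, sq_abs,
      ← mul_assoc, mul_pow _ (gate _), mul_comm (Z.amplitude * Z.length⁻¹)]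
    exact mul_le_of_le_one_right (sq_nonneg _) hgate
  · rw [Finset.sum_eq_zero fun c _ => hcoord c (by omega)]
    positivity

variable {M : Fin n → ℝ≥0∞} {σ : ℝ}

lemma frontierPart_eq_zero
    (hZ : IsProfile M (Z.amplitude * Z.length⁻¹) σ (Z.weight (R m)) (Z.prob (R m)))
    (hx : SuppBelow m x) (hp : Z.prob (R m) i = 0) :
    frontierPart Z m R i x = 0 := by
  have h := norm_sq_frontierPart_le (Z := Z) (R := R) (i := i) hx
  rw [hZ.weight_eq_zero _ hp, mul_zero, zero_mul, zero_pow two_ne_zero] at h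
  exact norm_eq_zero.1 (pow_eq_zero_iff two_ne_zero |>.1 (h.antisymm (sq_nonneg _)))

lemma mean_gradError
    (hZ : IsProfile M (Z.amplitude * Z.length⁻¹) σ (Z.weight (R m)) (Z.prob (R m))) :
    Z.prob (R m) i • gradError Z m R i x True +
      (1 - Z.prob (R m) i) • gradError Z m R i x False = 0 := by
  by_cases hx : SuppBelow m x
  · simp only [gradError, if_pos hx, if_true, if_false]
    by_cases hp : Z.prob (R m) i = 0
    · simp [frontierPart_eq_zero hZ hx hp]
    · match_scalars
      field_simp
      ring
  · simp [gradError, hx]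

lemma mean_norm_sq_gradError_le
    (hZ : IsProfile M (Z.amplitude * Z.length⁻¹) σ (Z.weight (R m)) (Z.prob (R m))) :
    Z.prob (R m) i * ‖gradError Z m R i x True‖ ^ 2 +
      (1 - Z.prob (R m) i) * ‖gradError Z m R i x False‖ ^ 2 ≤ σ ^ 2 := by
  by_cases hx : SuppBelow m x
  · simp only [gradError, if_pos hx, if_true, if_false]
    by_cases hp : Z.prob (R m) i = 0
    · simp [frontierPart_eq_zero hZ hx hp, sq_nonneg]
    · have hpos : 0 < Z.prob (R m) i := lt_of_le_of_ne (hZ.prob_nonneg i) (Ne.symm hp)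
      have hle := hZ.prob_le_one i
      simp only [norm_smul, mul_pow, Real.norm_eq_abs, sq_abs]
      calc _ = ‖frontierPart Z m R i x‖ ^ 2 * (1 - Z.prob (R m) i) / Z.prob (R m) i := by
            field_simp; ring
        _ ≤ (n * Z.weight (R m) i * (Z.amplitude * Z.length⁻¹)) ^ 2 *
              (1 - Z.prob (R m) i) / Z.prob (R m) i := by
            refine div_le_div_of_nonneg_right ?_ hpos.le
            exact mul_le_mul_of_nonneg_right (norm_sq_frontierPart_le hx) (by linarith)
        _ ≤ σ ^ 2 := by
            rw [div_le_iff₀ hpos, mul_comm (σ ^ 2)]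
            exact hZ.variance i
  · simpa [gradError, hx] using sq_nonneg σ

end GradError

/-- The rounds start at increasing times, and the weights and success probabilities of every round
form a profile for the work that the workers can do in this round. -/
structure Resisting.IsCalibrated {n : ℕ} (Z : Resisting n) (v : Fin n → ℝ≥0 → ℝ≥0) (σ : ℝ) :
    Prop where
  start_mono : Monotone Z.start
  start_zero : Z.start 0 = 0
  isProfile : ∀ r, IsProfile (maxWork v (Z.start r) (Z.start (r + 1)))
    (Z.amplitude * Z.length⁻¹) σ (Z.weight r) (Z.prob r)

lemma Resisting.IsCalibrated.prob_mem {n : ℕ} {Z : Resisting n} {v : Fin n → ℝ≥0 → ℝ≥0} {σ : ℝ}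
    (hZ : Z.IsCalibrated v σ) (r : ℕ) (i : Fin n) : Z.prob r i ∈ unitInterval :=
  ⟨(hZ.isProfile r).prob_nonneg i, (hZ.isProfile r).prob_le_one i⟩

section Unbiased

variable {n d k : ℕ} {Z : Resisting n} {v : Fin n → ℝ≥0 → ℝ≥0} {A : Algorithm n d}

lemma stochGrad_sub_localGrad (hA : IsZeroRespecting A) (ω : ℕ → unitInterval) (k : ℕ) (i : Fin n)
    (x : EuclideanSpace ℝ (Fin d)) (t : ℝ≥0) :
    let S := sim Z v A ω k
    stochGrad Z i x (randomElement Z v A k ω) t - localGrad Z (finalRounds Z v A ω) i x =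
      gradError Z S.found S.activation i x ((ω k : ℝ) < Z.prob S.currentRound i) := by
  intro S
  have hrounds (j : ℕ) (hj : j ≤ S.found) : finalRounds Z v A ω j = S.activation j :=
    finalRounds_eq hA ω hj
  simp only [stochGrad, randomElement]
  rw [noisyGrad_sub_localGrad, gradError_congr hrounds, hrounds _ le_rfl]

lemma sim_answers_castLE (ω : ℕ → unitInterval) {l : ℕ} (h : l ≤ k) :
    (fun j : Fin l => (sim Z v A ω k).answers (Fin.castLE h j)) = (sim Z v A ω l).answers := by
  induction k, h using Nat.le_induction with
  | base => rfl
  | succ k hk ih =>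
    rw [← ih]
    funext j
    exact Fin.snoc_castSucc (α := fun _ => EuclideanSpace ℝ (Fin d)) _ _ (Fin.castLE hk j)

variable (Z v A) in
/-- The information about the run of the resisting oracle before the call of iteration `k`,
including the gradients at `X`. -/
abbrev simInfo (k : ℕ) (X : (ℕ → unitInterval) → EuclideanSpace ℝ (Fin d)) :
    MeasurableSpace (ℕ → unitInterval) :=
  callInfo v A (fun ω => localFun Z (finalRounds Z v A ω)) (stochGrad Z) (randomElement Z v A) k X

variable (x : (Fin k → EuclideanSpace ℝ (Fin d)) → EuclideanSpace ℝ (Fin d))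

lemma isSimpleMap_localGrad (hA : IsZeroRespecting A) (i : Fin n) :
    IsSimpleMap MeasurableSpace.pi fun ω =>
      localGrad Z (finalRounds Z v A ω) i (x (sim Z v A ω k).answers) :=
  ((isSimpleMap_sim (Z := Z) (v := v) (A := A) k).prodMk (isSimpleMap_finalRounds hA)).comp
    fun y => localGrad Z y.2 i (x y.1.answers)

lemma simInfo_le (hA : IsZeroRespecting A) :
    simInfo Z v A k (fun ω => x (sim Z v A ω k).answers) ≤ MeasurableSpace.pi := by
  refine sup_le (sup_le ?_ (iSup₂_le fun l j => ?_)) (iSup_le fun j => ?_)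
  all_goals refine Measurable.comap_le (IsSimpleMap.measurable ?_)
  · simp only [transcript_eq_sim hA]
    exact (isSimpleMap_sim k).comp SimState.answers
  · simp only [gradient_localFun, iterate_eq_sim hA]
    exact isSimpleMap_localGrad (fun a => (A l a).point) hA j
  · simp only [gradient_localFun]
    exact isSimpleMap_localGrad x hA j

lemma simInfo_le_determinedOn (hA : IsZeroRespecting A) :
    simInfo Z v A k (fun ω => x (sim Z v A ω k).answers) ≤
      determinedOn (fun ω => sim Z v A ω k) {S | SuppBelow S.found (x S.answers)} := by
  have hrounds (ω : ℕ → unitInterval) (j : ℕ) (hj : j ≤ (sim Z v A ω k).found) :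
      finalRounds Z v A ω j = (sim Z v A ω k).activation j := finalRounds_eq hA ω hj
  refine sup_le (sup_le ?_ (iSup₂_le fun l j => ?_)) (iSup_le fun j => ?_)
  · exact comap_le_determinedOn SimState.answers fun ω _ => transcript_eq_sim hA ω k
  · have hl : (l : ℕ) ≤ k := Nat.lt_succ_iff.1 l.2
    refine comap_le_determinedOn (fun S => localGrad Z S.activation j
      (A l fun a => S.answers (Fin.castLE hl a)).point) fun ω _ => ?_
    rw [gradient_localFun, iterate_eq_sim hA, sim_answers_castLE ω hl]
    exact localGrad_congr j (((simInv_sim hA ω l).suppBelow_point hA).mono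
      (sim_found_mono ω hl)) (hrounds ω)
  · refine comap_le_determinedOn (fun S => localGrad Z S.activation j (x S.answers))
      fun ω hω => ?_
    rw [gradient_localFun]
    exact localGrad_congr j hω (hrounds ω)

lemma unbiasedBoundedVariance {σ : ℝ} (hA : IsZeroRespecting A) (hZ : Z.IsCalibrated v σ) :
    UnbiasedBoundedVariance uniformSeq v A σ (fun ω => localFun Z (finalRounds Z v A ω))
      (stochGrad Z) (randomElement Z v A) := by
  intro k i x t τ X G D m
  let T : (ℕ → unitInterval) → SimState n d k := fun ω => sim Z v A ω k
  let p : SimState n d k → ℝ := fun S => Z.prob S.currentRound i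
  let err : SimState n d k → Prop → EuclideanSpace ℝ (Fin d) :=
    fun S b => gradError Z S.found S.activation i (x S.answers) b
  let E : (ℕ → unitInterval) → EuclideanSpace ℝ (Fin d) :=
    fun ω => err (T ω) ((ω k : ℝ) < p (T ω))
  have hX : X = fun ω => x (T ω).answers := funext fun ω => congrArg x (transcript_eq_sim hA ω k)
  have hD : D = fun ω => localGrad Z (finalRounds Z v A ω) i (x (T ω).answers) := by
    funext ω
    simp only [D, hX, gradient_localFun]
  have hsub (ω : ℕ → unitInterval) : G ω - D ω = E ω := by
    simp only [G, hD, hX]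
    exact stochGrad_sub_localGrad hA ω k i _ _
  have hG : G = D + E := funext fun ω => eq_add_of_sub_eq' (hsub ω)
  have hm : m ≤ MeasurableSpace.pi := by simpa only [m, hX] using simInfo_le x hA
  have hmT : m ≤ determinedOn T {S | SuppBelow S.found (x S.answers)} := by
    simpa only [m, hX] using simInfo_le_determinedOn x hA
  have hDm : Measurable[m] D := measurable_iff_comap_le.2 <| le_sup_of_le_right <|
    le_iSup_of_le i le_rfl
  have hT : IsSimpleMap (coordsBefore k) T := isSimpleMap_sim_coordsBefore k
  have hp (S : SimState n d k) : p S ∈ unitInterval := hZ.prob_mem _ _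
  have herr (S : SimState n d k) (hS : ¬ SuppBelow S.found (x S.answers)) (b : Prop) :
      err S b = 0 := if_neg hS
  have hE : IsSimpleMap MeasurableSpace.pi E := (isSimpleMap_coin hT err p).mono (coordsBefore_le _)
  have hDint : Integrable D uniformSeq := hD ▸ (isSimpleMap_localGrad x hA i).integrable _
  simp only [hsub]
  refine ⟨hm, hG ▸ hDint.add (hE.integrable _), ?_, (hE.comp fun y => ‖y‖ ^ 2).integrable _, ?_⟩
  · rw [hG]
    exact condExp_add_coin hT hm hmT hDm.stronglyMeasurable hDint herr hp
      fun S => mean_gradError (hZ.isProfile _)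
  · exact condExp_coin_le hT hm hmT (h := fun S b => ‖err S b‖ ^ 2)
      (fun S hS b => by rw [herr S hS, norm_zero, zero_pow two_ne_zero]) hp
      fun S => mean_norm_sq_gradError_le (hZ.isProfile _)

end Unbiased

/-! ### Counting discoveries within a round -/

section WorkRecord

/-- A worker with computation power `u` has by time `τ` completed `N` computations since time `s`,
the last one at time `t`, and all of them before time `s'`. Without any computation, `t` is just
some time from which the next one is counted. -/
structure WorkRecord (u : ℝ≥0 → ℝ≥0) (s s' : ℝ≥0∞) (τ : ℝ≥0) (N : ℕ) (t : ℝ≥0) : Prop where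
  last_le : t ≤ τ
  le_last : s ≤ t
  work : (N : ℝ≥0∞) ≤ V u t - V u s
  last_lt : N ≠ 0 → (t : ℝ≥0∞) < s'

variable {u : ℝ≥0 → ℝ≥0} {s s' : ℝ≥0∞} {τ τ' t t₀ : ℝ≥0} {N : ℕ}

lemma workRecord_zero (h : s ≤ t) : WorkRecord u s s' t 0 t :=
  ⟨le_rfl, h, by simp, fun h0 => absurd rfl h0⟩

lemma WorkRecord.mono (h : WorkRecord u s s' τ N t) (hτ : τ ≤ τ') : WorkRecord u s s' τ' N t :=
  ⟨h.last_le.trans hτ, h.le_last, h.work, h.last_lt⟩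

lemma WorkRecord.succ (h : WorkRecord u s s' τ N t) (hu : V u t₀ < ⊤) (ht₀ : t ≤ t₀)
    (hwork : 1 ≤ V u τ' - V u t₀) (hτ : τ ≤ τ') (hτ' : (τ' : ℝ≥0∞) < s') :
    WorkRecord u s s' τ' (N + 1) τ' where
  last_le := le_rfl
  le_last := h.le_last.trans (ENNReal.coe_le_coe.2 (h.last_le.trans hτ))
  work := by
    have hst : V u s ≤ V u t := V_mono u h.le_last
    have htt₀ : V u t ≤ V u t₀ := V_mono u (ENNReal.coe_le_coe.2 ht₀)
    refine ENNReal.le_sub_of_add_le_right ((hst.trans htt₀).trans_lt hu).ne ?_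
    calc ((N + 1 : ℕ) : ℝ≥0∞) + V u s = 1 + (N + V u s) := by push_cast; ring
      _ ≤ (V u τ' - V u t₀) + V u t := by
          gcongr
          exact (add_le_add_left h.work _).trans_eq (tsub_add_cancel_of_le hst)
      _ ≤ (V u τ' - V u t₀) + V u t₀ := by gcongr
      _ = V u τ' := tsub_add_cancel_of_le (tsub_pos_iff_lt.1 (zero_lt_one.trans_le hwork)).le
  last_lt _ := hτ'

end WorkRecord

section Counting

variable {n d : ℕ} (Z : Resisting n) (v : Fin n → ℝ≥0 → ℝ≥0) (A : Algorithm n d)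

/-- The query collects, before the end of the current round, a computation whose result can reveal
a coordinate. -/
structure Useful {k : ℕ} (S : SimState n d k) : Prop extends Completes v A S where
  chainVar_ne_zero : chainVar Z.length (S.called A).point S.found ≠ 0
  time_lt : ((S.query A).time : ℝ≥0∞) < Z.start (S.currentRound + 1)

/-- A bound for the conditional probability of a discovery in the current round. -/
def hazard {k : ℕ} (S : SimState n d k) : ℝ :=
  open scoped Classical in if Useful Z v A S then coinProb Z A S else 0

/-- The indicator of a discovery in the current round, i.e. in the round of the previous
discovery. -/
def early {k : ℕ} (S : SimState n d k) (b : Prop) : ℝ :=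
  open scoped Classical in
  if Discovers Z v A S b ∧ ((S.query A).time : ℝ≥0∞) < Z.start (S.currentRound + 1) then 1 else 0

/-- The number of early discoveries before iteration `N`. -/
def earlyCount (ω : ℕ → unitInterval) (N : ℕ) : ℝ :=
  ∑ l ∈ Finset.range N, early Z v A (sim Z v A ω l) ((ω l : ℝ) < coinProb Z A (sim Z v A ω l))

/-- The times of the simulated protocol. -/
def simTime (ω : ℕ → unitInterval) : ℕ → ℝ≥0
  | 0 => 0
  | k + 1 => ((sim Z v A ω k).query A).time

/-- At time `τ`, worker `i` has completed `cnt i` useful computations since the current round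
started, the last one at time `last i`, and `Q` is the sum of the hazards since the start of the
protocol. A computation that is still running at a point where it can reveal the next coordinate
started after `last i`. -/
structure CountInv {k : ℕ} (S : SimState n d k) (τ : ℝ≥0) (Q : ℝ) (cnt : Fin n → ℕ)
    (last : Fin n → ℝ≥0) : Prop where
  budget : Q ≤ S.found / 4 + ∑ i, Z.prob S.currentRound i * cnt i
  record : ∀ i, WorkRecord (v i) (Z.start S.currentRound) (Z.start (S.currentRound + 1)) τ
    (cnt i) (last i)
  last_le_time : ∀ i, (S.workers i).busy = true →
    chainVar Z.length (S.workers i).point S.found ≠ 0 → last i ≤ (S.workers i).time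

/-- The state `S` with the called worker updated, before a discovery is recorded. -/
def updateCalled {k : ℕ} (S : SimState n d k) (b : Prop) : SimState n d k :=
  { S with workers := Function.update S.workers (S.query A).worker (simAnswer Z v A S b).1 }

variable {Z v A} {k : ℕ} {S : SimState n d k} {b : Prop} {σ : ℝ}

lemma iterTime_eq_simTime (hA : IsZeroRespecting A) (ω : ℕ → unitInterval) (k : ℕ) :
    iterTime v A (realize (stochGrad Z) (randomElement Z v A) ω) k = simTime Z v A ω k := by
  cases k with
  | zero => rfl
  | succ k => rw [iterTime, transcript_eq_sim hA, simTime]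

lemma simTime_le_succ (hA : IsZeroRespecting A) (ω : ℕ → unitInterval) (k : ℕ) :
    simTime Z v A ω k ≤ simTime Z v A ω (k + 1) := by
  cases k with
  | zero => exact zero_le
  | succ k =>
    have hinit : Fin.init (sim Z v A ω (k + 1)).answers = (sim Z v A ω k).answers := by
      simp [sim, simStep, Fin.init_snoc]
    simpa only [simTime, hinit] using hA.time_mono k (sim Z v A ω (k + 1)).answers

lemma Discovers.completes (h : Discovers Z v A S b) : Completes v A S := by
  obtain ⟨c, -, hne⟩ := h
  by_contra hS
  exact hne (by simp [simAnswer_snd_of_not_completes hS])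

lemma Discovers.coin_and_chainVar_ne_zero (h : Discovers Z v A S b) (hS : SimInv S) :
    b ∧ chainVar Z.length (S.called A).point S.found ≠ 0 := by
  obtain ⟨c, hc, hne⟩ := id h
  rw [simAnswer_of_completes h.completes] at hne
  exact of_noisyGrad_apply_ne_zero (hS.suppBelow_workers _) hc hne

lemma mean_early_le (hS : SimInv S) (hp : 0 ≤ coinProb Z A S) :
    coinProb Z A S • early Z v A S True + (1 - coinProb Z A S) • early Z v A S False ≤
      hazard Z v A S := by
  have hFalse : early Z v A S False = 0 :=
    if_neg fun h => (h.1.coin_and_chainVar_ne_zero hS).1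
  rw [hFalse, smul_zero, add_zero]
  by_cases hearly : Discovers Z v A S True ∧
      ((S.query A).time : ℝ≥0∞) < Z.start (S.currentRound + 1)
  · have huseful : Useful Z v A S :=
      ⟨hearly.1.completes, (hearly.1.coin_and_chainVar_ne_zero hS).2, hearly.2⟩
    rw [early, hazard, if_pos hearly, if_pos huseful, smul_eq_mul, mul_one]
  · rw [early, if_neg hearly, smul_zero, hazard]
    split_ifs <;> simp [hp]

section CountInv

variable {τ : ℝ≥0} {Q : ℝ} {cnt : Fin n → ℕ} {last : Fin n → ℝ≥0}

lemma CountInv.le_found_add_one (h : CountInv Z v S τ Q cnt last) (hZ : Z.IsCalibrated v σ)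
    (hv : ∀ i (t : ℝ≥0), V (v i) t < ⊤) : Q ≤ (S.found + 1) / 4 := by
  have hcnt (i : Fin n) : (cnt i : ℝ≥0∞) ≤
      maxWork v (Z.start S.currentRound) (Z.start (S.currentRound + 1)) i := by
    by_cases h0 : cnt i = 0
    · simp [h0]
    · exact le_maxWork (hv i _) ((h.record i).last_lt h0) (h.record i).work
  linarith [h.budget, (hZ.isProfile S.currentRound).sum_prob_le cnt hcnt]

lemma CountInv.updateCalled_of_useful (h : CountInv Z v S τ Q cnt last)
    (hv : ∀ i (t : ℝ≥0), V (v i) t < ⊤) (hτ : τ ≤ (S.query A).time) (hS : Useful Z v A S)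
    (b : Prop) :
    CountInv Z v (updateCalled Z v A S b) (S.query A).time (Q + coinProb Z A S)
      (cnt + Pi.single (S.query A).worker 1)
      (Function.update last (S.query A).worker (S.query A).time) where
  budget := by
    have hsum : ∑ i, Z.prob S.currentRound i *
        ((cnt + Pi.single (S.query A).worker 1 : Fin n → ℕ) i : ℝ) =
        ∑ i, Z.prob S.currentRound i * cnt i + coinProb Z A S := by
      simp [mul_add, Finset.sum_add_distrib, coinProb, Pi.single_apply]
    refine le_of_le_of_eq ?_ (congrArg ((S.found : ℝ) / 4 + ·) hsum).symm
    linarith [h.budget]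
  record i := by
    by_cases hi : i = (S.query A).worker
    · subst hi
      simpa [updateCalled] using (h.record _).succ (hv _ _)
        (h.last_le_time _ hS.busy_eq hS.chainVar_ne_zero) hS.one_le_work hτ hS.time_lt
    · simpa [updateCalled, hi] using (h.record i).mono hτ
  last_le_time i := by
    by_cases hi : i = (S.query A).worker
    · subst hi
      simp [updateCalled, simAnswer_of_completes hS.toCompletes, idle]
    · simpa [updateCalled, hi] using h.last_le_time i

lemma CountInv.updateCalled_of_not_useful (h : CountInv Z v S τ Q cnt last)
    (hτ : τ ≤ (S.query A).time) (b : Prop) :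
    CountInv Z v (updateCalled Z v A S b) (S.query A).time Q cnt last where
  budget := h.budget
  record i := (h.record i).mono hτ
  last_le_time i := by
    by_cases hi : i = (S.query A).worker
    · subst hi
      simp only [updateCalled, Function.update_self]
      unfold simAnswer oracle
      split_ifs
      · simp [idle]
      · exact fun _ _ => (h.record _).last_le.trans hτ
      · exact h.last_le_time _
      · simp [idle]
    · simpa [updateCalled, hi] using h.last_le_time i

lemma CountInv.exists_updateCalled (h : CountInv Z v S τ Q cnt last)
    (hv : ∀ i (t : ℝ≥0), V (v i) t < ⊤) (hτ : τ ≤ (S.query A).time) (b : Prop) :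
    ∃ cnt' last', CountInv Z v (updateCalled Z v A S b) (S.query A).time
      (Q + hazard Z v A S) cnt' last' := by
  by_cases hS : Useful Z v A S
  · rw [hazard, if_pos hS]
    exact ⟨_, _, h.updateCalled_of_useful hv hτ hS b⟩
  · rw [hazard, if_neg hS, add_zero]
    exact ⟨_, _, h.updateCalled_of_not_useful hτ b⟩

lemma countInv_simStep_of_discovers (hS : SimInv S) (hZ : Z.IsCalibrated v σ)
    (hb : Discovers Z v A S b) (hQ : Q ≤ (S.found + 1) / 4) :
    CountInv Z v (simStep Z v A S b) (S.query A).time Q 0 fun _ => (S.query A).time where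
  budget := by simpa [simStep, hb] using hQ
  record _ := workRecord_zero <| by
    simpa [simStep, SimState.currentRound, hb] using Resisting.start_round_le hZ.start_zero _
  last_le_time i hbusy hne := by
    refine absurd ?_ hne
    simp only [simStep, hb, if_true] at hbusy ⊢
    by_cases hi : i = (S.query A).worker
    · subst hi
      simp [simAnswer_of_completes hb.completes, idle] at hbusy
    · rw [Function.update_of_ne hi]
      exact (hS.suppBelow_workers i).chainVar_eq_zero (Nat.lt_succ_self _)

lemma CountInv.exists_simStep (h : CountInv Z v S τ Q cnt last) (hS : SimInv S)
    (hZ : Z.IsCalibrated v σ) (hv : ∀ i (t : ℝ≥0), V (v i) t < ⊤) (hτ : τ ≤ (S.query A).time)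
    (b : Prop) :
    ∃ cnt' last', CountInv Z v (simStep Z v A S b) (S.query A).time
      (Q + hazard Z v A S) cnt' last' := by
  obtain ⟨cnt', last', h'⟩ := h.exists_updateCalled hv hτ b
  by_cases hb : Discovers Z v A S b
  · exact ⟨_, _, countInv_simStep_of_discovers hS hZ hb (h'.le_found_add_one hZ hv)⟩
  · refine ⟨cnt', last', ?_, ?_, ?_⟩ <;> simp only [simStep, SimState.currentRound, hb, if_false]
    · exact h'.budget
    · exact h'.record
    · exact h'.last_le_time

end CountInv

lemma exists_countInv (hA : IsZeroRespecting A) (hZ : Z.IsCalibrated v σ)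
    (hv : ∀ i (t : ℝ≥0), V (v i) t < ⊤) (ω : ℕ → unitInterval) (k : ℕ) :
    ∃ cnt last, CountInv Z v (sim Z v A ω k) (simTime Z v A ω k)
      (∑ l ∈ Finset.range k, hazard Z v A (sim Z v A ω l)) cnt last := by
  induction k with
  | zero =>
    refine ⟨0, fun _ => 0, by simp [sim], fun _ => workRecord_zero ?_, by simp⟩
    simp [sim, hZ.start_zero]
  | succ k ih =>
    obtain ⟨cnt, last, h⟩ := ih
    rw [Finset.sum_range_succ]
    exact h.exists_simStep (simInv_sim hA ω k) hZ hv (simTime_le_succ hA ω k) _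

lemma sum_hazard_le (hA : IsZeroRespecting A) (hZ : Z.IsCalibrated v σ)
    (hv : ∀ i (t : ℝ≥0), V (v i) t < ⊤) (ω : ℕ → unitInterval) (N : ℕ) :
    ∑ l ∈ Finset.range N, hazard Z v A (sim Z v A ω l) ≤ (d + 1) / 4 := by
  obtain ⟨cnt, last, h⟩ := exists_countInv hA hZ hv ω N
  have hfound : ((sim Z v A ω N).found : ℝ) ≤ d := by exact_mod_cast (simInv_sim hA ω N).found_le
  linarith [h.le_found_add_one hZ hv]

lemma isSimpleMap_early (l : ℕ) : IsSimpleMap MeasurableSpace.pi fun ω =>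
    early Z v A (sim Z v A ω l) ((ω l : ℝ) < coinProb Z A (sim Z v A ω l)) :=
  (isSimpleMap_coin (isSimpleMap_sim_coordsBefore l) (early Z v A) (coinProb Z A)).mono
    (coordsBefore_le _)

lemma integrable_earlyCount (N : ℕ) :
    Integrable (fun ω => earlyCount Z v A ω N) uniformSeq :=
  integrable_finsetSum _ fun l _ => (isSimpleMap_early l).integrable _

lemma integral_early_le_integral_hazard (hA : IsZeroRespecting A) (hZ : Z.IsCalibrated v σ)
    (l : ℕ) :
    ∫ ω, early Z v A (sim Z v A ω l) ((ω l : ℝ) < coinProb Z A (sim Z v A ω l)) ∂uniformSeq ≤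
      ∫ ω, hazard Z v A (sim Z v A ω l) ∂uniformSeq := by
  rw [integral_coin (isSimpleMap_sim_coordsBefore l) (early Z v A)
    (p := coinProb Z A) fun S => hZ.prob_mem _ _]
  refine integral_mono ?_ (((isSimpleMap_sim l).comp (hazard Z v A)).integrable _) fun ω =>
    mean_early_le (simInv_sim hA ω l) (hZ.prob_mem _ _).1
  exact ((isSimpleMap_sim l).comp fun S => coinProb Z A S • early Z v A S True +
    (1 - coinProb Z A S) • early Z v A S False).integrable _

lemma integral_earlyCount_le (hA : IsZeroRespecting A) (hZ : Z.IsCalibrated v σ)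
    (hv : ∀ i (t : ℝ≥0), V (v i) t < ⊤) (N : ℕ) :
    ∫ ω, earlyCount Z v A ω N ∂uniformSeq ≤ (d + 1) / 4 := by
  have hint (l : ℕ) : Integrable (fun ω => hazard Z v A (sim Z v A ω l)) uniformSeq :=
    ((isSimpleMap_sim l).comp _).integrable _
  calc ∫ ω, earlyCount Z v A ω N ∂uniformSeq
      = ∑ l ∈ Finset.range N, ∫ ω, early Z v A (sim Z v A ω l)
          ((ω l : ℝ) < coinProb Z A (sim Z v A ω l)) ∂uniformSeq :=
        integral_finsetSum _ fun l _ => (isSimpleMap_early l).integrable _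
    _ ≤ ∑ l ∈ Finset.range N, ∫ ω, hazard Z v A (sim Z v A ω l) ∂uniformSeq :=
        Finset.sum_le_sum fun l _ => integral_early_le_integral_hazard hA hZ l
    _ = ∫ ω, ∑ l ∈ Finset.range N, hazard Z v A (sim Z v A ω l) ∂uniformSeq :=
        (integral_finsetSum _ fun l _ => hint l).symm
    _ ≤ ∫ _, ((d : ℝ) + 1) / 4 ∂uniformSeq :=
        integral_mono (integrable_finsetSum _ fun l _ => hint l) (integrable_const _)
          fun ω => sum_hazard_le hA hZ hv ω N
    _ = (d + 1) / 4 := by simp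

lemma early_nonneg (S : SimState n d k) (b : Prop) : 0 ≤ early Z v A S b := by
  unfold early
  split_ifs <;> norm_num

lemma earlyCount_nonneg (ω : ℕ → unitInterval) (N : ℕ) : 0 ≤ earlyCount Z v A ω N :=
  Finset.sum_nonneg fun _ _ => early_nonneg _ _

lemma earlyCount_mono (ω : ℕ → unitInterval) : Monotone (earlyCount Z v A ω) :=
  fun _ _ h => Finset.sum_le_sum_of_subset_of_nonneg (Finset.range_subset_range.2 h)
    fun _ _ _ => early_nonneg _ _

lemma start_currentRound_le_simTime (hA : IsZeroRespecting A) (hZ : Z.start 0 = 0)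
    (ω : ℕ → unitInterval) (k : ℕ) :
    Z.start (sim Z v A ω k).currentRound ≤ simTime Z v A ω k := by
  induction k with
  | zero => simp [sim, hZ]
  | succ k ih =>
    simp only [sim, simStep]
    split_ifs
    · simpa [SimState.currentRound, simTime] using Resisting.start_round_le hZ _
    · exact ih.trans (ENNReal.coe_le_coe.2 (simTime_le_succ hA ω k))

lemma found_simStep_add_currentRound_le (hmono : Monotone Z.start)
    (hround : S.currentRound ≤ Z.last) (hstart : Z.start S.currentRound ≤ (S.query A).time)
    (hend : ((S.query A).time : ℝ≥0∞) < Z.start Z.last) (b : Prop) :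
    ((simStep Z v A S b).found : ℝ) + S.currentRound ≤
      S.found + early Z v A S b + (simStep Z v A S b).currentRound := by
  by_cases hb : Discovers Z v A S b
  · simp only [simStep, SimState.currentRound, hb, if_true, Function.update_self]
    push_cast
    by_cases htime : ((S.query A).time : ℝ≥0∞) < Z.start (S.currentRound + 1)
    · have hle : (S.currentRound : ℝ) ≤ Z.round (S.query A).time :=
        Nat.cast_le.2 (Resisting.le_round hround hstart)
      rw [early, if_pos ⟨hb, htime⟩]
      linarith
    · have hlast : S.currentRound + 1 ≤ Z.last :=
        (hmono.reflect_lt ((not_lt.1 htime).trans_lt hend)).le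
      have hle : ((S.currentRound + 1 : ℕ) : ℝ) ≤ Z.round (S.query A).time :=
        Nat.cast_le.2 (Resisting.le_round hlast (not_lt.1 htime))
      push_cast at hle
      linarith [early_nonneg (Z := Z) (v := v) (A := A) S b]
  · simp only [simStep, SimState.currentRound, hb, if_false]
    linarith [early_nonneg (Z := Z) (v := v) (A := A) S b]

-- Every discovery is early or advances the current round.
lemma found_le_earlyCount_add_currentRound (hA : IsZeroRespecting A) (hmono : Monotone Z.start)
    (hzero : Z.start 0 = 0) (ω : ℕ → unitInterval) (k : ℕ)
    (hk : (simTime Z v A ω k : ℝ≥0∞) < Z.start Z.last) :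
    ((sim Z v A ω k).found : ℝ) ≤ earlyCount Z v A ω k + (sim Z v A ω k).currentRound := by
  induction k with
  | zero => simp [sim, earlyCount]
  | succ k ih =>
    have htime : (simTime Z v A ω k : ℝ≥0∞) ≤ simTime Z v A ω (k + 1) :=
      ENNReal.coe_le_coe.2 (simTime_le_succ hA ω k)
    have hstep := found_simStep_add_currentRound_le (v := v) hmono (sim_activation_le ω k _)
      ((start_currentRound_le_simTime hA hzero ω k).trans htime) hk
      ((ω k : ℝ) < coinProb Z A (sim Z v A ω k))
    rw [earlyCount, Finset.sum_range_succ, ← earlyCount, sim]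
    linarith [ih (htime.trans_lt hk)]

lemma last_add_one_le_earlyCount (hA : IsZeroRespecting A) (hmono : Monotone Z.start)
    (hzero : Z.start 0 = 0) {ω : ℕ → unitInterval}
    (hk : (simTime Z v A ω k : ℝ≥0∞) < Z.start Z.last)
    (hfound : 2 * Z.last ≤ (sim Z v A ω k).found) :
    (Z.last : ℝ) + 1 ≤ earlyCount Z v A ω k := by
  have hlt : (sim Z v A ω k).currentRound < Z.last :=
    hmono.reflect_lt ((start_currentRound_le_simTime hA hzero ω k).trans_lt hk)
  have hround : ((sim Z v A ω k).currentRound : ℝ) + 1 ≤ Z.last := by exact_mod_cast hlt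
  have hfound' : (2 : ℝ) * Z.last ≤ (sim Z v A ω k).found := by exact_mod_cast hfound
  linarith [found_le_earlyCount_add_currentRound hA hmono hzero ω k hk]

lemma uniformSeq_le_earlyCount_le (hA : IsZeroRespecting A) (hZ : Z.IsCalibrated v σ)
    (hv : ∀ i (t : ℝ≥0), V (v i) t < ⊤) (hd : d = 2 * Z.last) (N : ℕ) :
    uniformSeq {ω | (Z.last : ℝ) + 1 ≤ earlyCount Z v A ω N} ≤ 2⁻¹ := by
  have hmarkov : ((Z.last : ℝ) + 1) *
      uniformSeq.real {ω | (Z.last : ℝ) + 1 ≤ earlyCount Z v A ω N} ≤ (d + 1) / 4 :=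
    (mul_meas_ge_le_integral_of_nonneg (.of_forall fun ω => earlyCount_nonneg ω N)
      (integrable_earlyCount N) _).trans (integral_earlyCount_le hA hZ hv N)
  have hdim : ((d : ℝ) + 1) / 4 ≤ (Z.last + 1) * 2⁻¹ := by
    rw [hd]
    push_cast
    linarith
  have hreal := le_of_mul_le_mul_left (hmarkov.trans hdim) (by positivity)
  rw [← ENNReal.toReal_le_toReal (measure_ne_top _ _) (by simp)]
  simpa [measureReal_def] using hreal

lemma exists_half_le_uniformSeq_found_lt (hA : IsZeroRespecting A) (hZ : Z.IsCalibrated v σ)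
    (hv : ∀ i (t : ℝ≥0), V (v i) t < ⊤) (hd : d = 2 * Z.last) :
    ∃ E : Set (ℕ → unitInterval), MeasurableSet E ∧ 2⁻¹ ≤ uniformSeq E ∧
      ∀ ω ∈ E, ∀ k, (simTime Z v A ω k : ℝ≥0∞) < Z.start Z.last → (sim Z v A ω k).found < d := by
  let B (N : ℕ) : Set (ℕ → unitInterval) := {ω | (Z.last : ℝ) + 1 ≤ earlyCount Z v A ω N}
  have hmeas : MeasurableSet (⋃ N, B N) := .iUnion fun N => measurableSet_le measurable_const <|
    Finset.measurable_sum _ fun l _ => (isSimpleMap_early l).measurable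
  have hmono : Monotone B := fun _ _ h ω hω => le_trans hω (earlyCount_mono ω h)
  have hunion : uniformSeq (⋃ N, B N) ≤ 2⁻¹ := by
    rw [hmono.measure_iUnion]
    exact iSup_le (uniformSeq_le_earlyCount_le hA hZ hv hd)
  refine ⟨(⋃ N, B N)ᶜ, hmeas.compl, ?_, fun ω hω k hk => ?_⟩
  · rw [prob_compl_eq_one_sub hmeas, ← ENNReal.one_sub_inv_two]
    exact tsub_le_tsub_left hunion 1
  · by_contra hge
    exact hω (Set.mem_iUnion.2 ⟨k, last_add_one_le_earlyCount hA hZ.start_mono hZ.start_zero hk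
      (hd ▸ not_lt.1 hge)⟩)

end Counting

/-! ### The lower bound -/

section LowerBound

variable {n d : ℕ} {Z : Resisting n} {v : Fin n → ℝ≥0 → ℝ≥0} {A : Algorithm n d} {σ ε : ℝ}

lemma average_localFun (hn : 0 < n) (hw : ∀ r, ∑ i, Z.weight r i = 1) (R : ℕ → ℕ) :
    average (localFun (d := d) Z R) = chainFun Z.amplitude Z.length 1 := by
  funext x
  simp only [average, localFun, chainFun]
  rw [← Finset.mul_sum, Finset.sum_comm, mul_left_comm, Finset.mul_sum]
  congr 1
  refine Finset.sum_congr rfl fun j _ => ?_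
  rw [← Finset.sum_mul, ← Finset.mul_sum, hw, ← mul_assoc, Pi.one_apply]
  field_simp

lemma measurable_localFun_finalRounds (hA : IsZeroRespecting A) (i : Fin n)
    (x : EuclideanSpace ℝ (Fin d)) :
    Measurable fun ω => localFun Z (finalRounds Z v A ω) i x :=
  ((isSimpleMap_finalRounds hA).comp fun R => localFun Z R i x).measurable

lemma measurable_randomElement (hA : IsZeroRespecting A) (k : ℕ) :
    Measurable (randomElement Z v A k) :=
  (((isSimpleMap_sim k).comp SimState.found).measurable.prodMk
    (isSimpleMap_finalRounds hA).measurable).prodMk (measurable_pi_apply k)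

lemma le_enorm_gradient_average_sq (hn : 0 < n) (hA : IsZeroRespecting A)
    (hw : ∀ r, ∑ i, Z.weight r i = 1) (ha : 0 ≤ Z.amplitude) (hℓ : 0 < Z.length)
    {ω : ℕ → unitInterval} {k : ℕ} (hfound : (sim Z v A ω k).found < d) :
    ENNReal.ofReal ((Z.amplitude * Z.length⁻¹ / 4) ^ 2) ≤
      ‖gradient (average (localFun Z (finalRounds Z v A ω)))
        (iterate v A (realize (stochGrad Z) (randomElement Z v A) ω) k)‖ₑ ^ 2 := by
  have hx := (simInv_sim (Z := Z) (v := v) hA ω k).suppBelow_point hA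
  rw [average_localFun hn hw, gradient_chainFun, iterate_eq_sim hA, ← ofReal_norm,
    ← ENNReal.ofReal_pow (norm_nonneg _)]
  gcongr
  exact le_norm_chainGrad_one ha hℓ (hx.chainVar_eq_zero hfound ▸ zero_lt_one)

lemma le_lintegral_iInf_enorm_gradient_sq (hn : 0 < n) (hA : IsZeroRespecting A)
    (hv : ∀ i (t : ℝ≥0), V (v i) t < ⊤) (hZ : Z.IsCalibrated v σ) (hd : d = 2 * Z.last)
    (hpos : 0 < Z.start Z.last) (ha : 0 ≤ Z.amplitude) (hℓ : 0 < Z.length) :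
    ENNReal.ofReal ((Z.amplitude * Z.length⁻¹ / 4) ^ 2) * 2⁻¹ ≤ ∫⁻ ω, ⨅ (k : ℕ)
      (_ : (iterTime v A (realize (stochGrad Z) (randomElement Z v A) ω) k : ℝ≥0∞) ≤
        Z.start Z.last / 2),
        ‖gradient (average (localFun Z (finalRounds Z v A ω)))
          (iterate v A (realize (stochGrad Z) (randomElement Z v A) ω) k)‖ₑ ^ 2 ∂uniformSeq := by
  obtain ⟨E, hE, hE_half, hfound⟩ := exists_half_le_uniformSeq_found_lt hA hZ hv hd
  have lt_of_le_half {t : ℝ≥0} (ht : (t : ℝ≥0∞) ≤ Z.start Z.last / 2) :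
      (t : ℝ≥0∞) < Z.start Z.last := by
    by_cases htop : Z.start Z.last = ⊤
    · exact htop ▸ ENNReal.coe_lt_top
    · exact ht.trans_lt (ENNReal.half_lt_self hpos.ne' htop)
  set b := ENNReal.ofReal ((Z.amplitude * Z.length⁻¹ / 4) ^ 2)
  calc b * 2⁻¹ ≤ b * uniformSeq E := by gcongr
    _ = ∫⁻ _ in E, b ∂uniformSeq := (setLIntegral_const _ _).symm
    _ ≤ _ := setLIntegral_mono' hE fun ω hω => le_iInf₂ fun k hk =>
        le_enorm_gradient_average_sq hn hA (fun r => (hZ.isProfile r).sum_weight) ha hℓ <|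
          hfound ω hω k (lt_of_le_half (iterTime_eq_simTime hA ω k ▸ hk))
    _ ≤ _ := setLIntegral_le_lintegral _ _

lemma exists_isCalibrated_lowerTime (hn : 0 < n) (hv : ∀ i (t : ℝ≥0), V (v i) t < ⊤) (hε : 0 < ε)
    {c₂ a ℓ : ℝ} (hC : a * ℓ⁻¹ ≠ 0) (hCε : 4 * c₂ * (a * ℓ⁻¹) ^ 2 ≤ ε) (σ : ℝ) (K : ℕ) :
    ∃ Z : Resisting n, Z.IsCalibrated v σ ∧ Z.amplitude = a ∧ Z.length = ℓ ∧
      Z.start = lowerTime v c₂ 1 σ ε ∧ Z.last = K := by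
  choose w p hprofile using exists_isProfile_lowerTime (σ := σ) hn hv hε hC hCε
  refine ⟨⟨a, ℓ, w, p, lowerTime v c₂ 1 σ ε, K⟩, ⟨lowerTime_mono hn, ?_, hprofile⟩,
    rfl, rfl, rfl, rfl⟩
  simp [lowerTime]

end LowerBound

section Scaling

/-! The amplitude `a` and the length `ℓ` solve `a / ℓ = 8 √ε` and `30 a / ℓ² = L`. -/

variable {L Δ ε : ℝ}

lemma amplitude_mul_inv_length (hL : L ≠ 0) (hε : 0 < ε) :
    1920 * ε / L * (240 * √ε / L)⁻¹ = 8 * √ε := by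
  field_simp
  rw [Real.sq_sqrt hε.le]
  ring

lemma amplitude_mul_inv_length_sq (hL : L ≠ 0) (hε : 0 < ε) :
    30 * (1920 * ε / L) * (240 * √ε / L)⁻¹ ^ 2 = L := by
  field_simp
  rw [Real.sq_sqrt hε.le]
  ring

lemma one_le_div_of_lt (hε : 0 < ε) (hε_lt : ε < 1 / 23040 * (L * Δ)) :
    1 ≤ 1 / 23040 * (L * Δ / ε) := by
  rw [← mul_div_assoc, one_le_div hε]
  exact hε_lt.le

lemma amplitude_mul_dim_le (hL : 0 < L) (hε : 0 < ε) (hε_lt : ε < 1 / 23040 * (L * Δ)) :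
    1920 * ε / L * (4 * ((2 * ⌊1 / 23040 * (L * Δ / ε)⌋₊ : ℕ) + 1)) ≤ Δ := by
  have hone := one_le_div_of_lt hε hε_lt
  have hfloor := Nat.floor_le (zero_le_one.trans hone)
  push_cast
  calc 1920 * ε / L * (4 * (2 * ⌊1 / 23040 * (L * Δ / ε)⌋₊ + 1))
      ≤ 1920 * ε / L * (12 * (1 / 23040 * (L * Δ / ε))) :=
        mul_le_mul_of_nonneg_left (by linarith) (by positivity)
    _ = Δ := by field_simp; norm_num

lemma ofReal_lt_half_slope_sq (hε : 0 < ε) :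
    ENNReal.ofReal ε < ENNReal.ofReal ((8 * √ε / 4) ^ 2) * 2⁻¹ := by
  have htwo : (8 * √ε / 4) ^ 2 = 2 * ε * 2 := by
    rw [div_pow, mul_pow, Real.sq_sqrt hε.le]
    ring
  rw [htwo, ENNReal.ofReal_mul (by positivity), ENNReal.ofReal_ofNat, mul_assoc,
    ENNReal.mul_inv_cancel two_ne_zero ENNReal.ofNat_ne_top, mul_one]
  exact (ENNReal.ofReal_lt_ofReal_iff (by positivity)).2 (by linarith)

end Scaling

end TimeOracle

end

open TimeOracle in
theorem theorem6_general (n : ℕ) (hn : 0 < n) (v : Fin n → ℝ≥0 → ℝ≥0)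
    (hv : ∀ i (t : ℝ≥0), V (v i) t < ⊤) (L Δ ε σ : ℝ) (hL : 0 < L) (hε : 0 < ε)
    (hε_lt : ε < 1 / 23040 * (L * Δ)) :
    ∃ d : ℕ, ∀ A : Algorithm n d, IsZeroRespecting A →
      ∃ (Ω Ξ : Type) (_ : MeasurableSpace Ω) (_ : MeasurableSpace Ξ)
        (P : Measure Ω) (_ : IsProbabilityMeasure P)
        (f : Ω → Fin n → EuclideanSpace ℝ (Fin d) → ℝ)
        (g : Fin n → EuclideanSpace ℝ (Fin d) → Ξ → ℝ≥0 → EuclideanSpace ℝ (Fin d))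
        (ξ : ℕ → Ω → Ξ),
        (∀ i x, Measurable fun ω => f ω i x) ∧
        (∀ k, Measurable (ξ k)) ∧
        (∀ ω i, Differentiable ℝ (f ω i)) ∧
        (∀ ω, IsAdmissible L Δ (average (f ω))) ∧
        UnbiasedBoundedVariance P v A σ f g ξ ∧
        ENNReal.ofReal ε <
          ∫⁻ ω, ⨅ (k : ℕ) (_ : (iterTime v A (realize g ξ ω) k : ℝ≥0∞) ≤
              lowerTime v (1 / 256) 1 σ ε ⌊1 / 23040 * (L * Δ / ε)⌋₊ / 2),
            ‖gradient (average (f ω)) (iterate v A (realize g ξ ω) k)‖ₑ ^ 2 ∂P := by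
  have hslope := amplitude_mul_inv_length hL.ne' hε
  obtain ⟨Z, hZ, ha, hℓ, hstart, hlast⟩ := exists_isCalibrated_lowerTime hn hv hε
    (c₂ := 1 / 256) (a := 1920 * ε / L) (ℓ := 240 * √ε / L) (by positivity)
    (by rw [hslope, mul_pow, Real.sq_sqrt hε.le]; linarith) σ ⌊1 / 23040 * (L * Δ / ε)⌋₊
  have ha_pos : 0 < Z.amplitude := ha ▸ by positivity
  have hℓ_pos : 0 < Z.length := hℓ ▸ by positivity
  have hstart_pos : 0 < Z.start Z.last := by
    rw [hstart, hlast]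
    exact lowerTime_pos (hv ⟨0, hn⟩ 1) (Nat.floor_pos.2 (one_le_div_of_lt hε hε_lt))
  refine ⟨2 * Z.last, fun A hA => ⟨ℕ → unitInterval, (ℕ × (ℕ → ℕ)) × unitInterval, inferInstance,
    inferInstance, uniformSeq, inferInstance, fun ω => localFun Z (finalRounds Z v A ω),
    stochGrad Z, randomElement Z v A, measurable_localFun_finalRounds hA,
    measurable_randomElement hA, fun _ _ => differentiable_chainFun _ _ _, fun ω => ?_,
    unbiasedBoundedVariance hA hZ, ?_⟩⟩
  · rw [average_localFun hn fun r => (hZ.isProfile r).sum_weight]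
    refine isAdmissible_chainFun_one ha_pos.le hℓ_pos ?_ ?_
    · rw [ha, hℓ, amplitude_mul_inv_length_sq hL.ne' hε]
    · rw [ha, hlast]
      exact amplitude_mul_dim_le hL hε hε_lt
  · rw [← hlast, ← hstart]
    refine lt_of_lt_of_le ?_
      (le_lintegral_iInf_enorm_gradient_sq hn hA hv hZ rfl hstart_pos ha_pos.le hℓ_pos)
    rw [ha, hℓ, hslope]
    exact ofReal_lt_half_slope_sq hε

open TimeOracle in
theorem theorem6 :
    ∃ c' c₁ c₂ c₃ : ℝ, 0 < c' ∧ 0 < c₁ ∧ 0 < c₂ ∧ 0 < c₃ ∧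
      ∀ (n : ℕ) (_ : 0 < n) (v : Fin n → ℝ≥0 → ℝ≥0) (_ : ∀ i, IsComputationPower (v i))
        (L Δ ε σ : ℝ) (_ : 0 < L) (_ : 0 < Δ) (_ : 0 < ε) (_ : 0 ≤ σ) (_ : ε < c' * (L * Δ)),
      ∃ d : ℕ, ∀ A : Algorithm n d, IsZeroRespecting A →
        ∃ (Ω Ξ : Type) (_ : MeasurableSpace Ω) (_ : MeasurableSpace Ξ)
          (P : Measure Ω) (_ : IsProbabilityMeasure P)
          (f : Ω → Fin n → EuclideanSpace ℝ (Fin d) → ℝ)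
          (g : Fin n → EuclideanSpace ℝ (Fin d) → Ξ → ℝ≥0 → EuclideanSpace ℝ (Fin d))
          (ξ : ℕ → Ω → Ξ),
          (∀ i x, Measurable fun ω => f ω i x) ∧
          (∀ k, Measurable (ξ k)) ∧
          (∀ ω i, Differentiable ℝ (f ω i)) ∧
          (∀ ω, IsAdmissible L Δ (average (f ω))) ∧
          UnbiasedBoundedVariance P v A σ f g ξ ∧
          ENNReal.ofReal ε <
            ∫⁻ ω, ⨅ (k : ℕ) (_ : (iterTime v A (realize g ξ ω) k : ℝ≥0∞) ≤
                lowerTime v c₂ c₃ σ ε ⌊c₁ * (L * Δ / ε)⌋₊ / 2),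
              ‖gradient (average (f ω)) (iterate v A (realize g ξ ω) k)‖ₑ ^ 2 ∂P := by
  refine ⟨1 / 23040, 1 / 23040, 1 / 256, 1, by norm_num, by norm_num, by norm_num, by norm_num, ?_⟩
  exact fun n hn v hv L Δ ε σ hL _ hε _ =>
    theorem6_general n hn v (fun i => (hv i).finite) L Δ ε σ hL hε
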